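/- Work over $\mathbb C$. Let $m,n\ge 0$, $\varkappa=m+n$, let $\boldsymbol s=(s_1,\dots,s_\varkappa)\in\{\pm1\}^{\varkappa}$ be a sequence in which $1$ occurs exactly $m$ times, and let $\boldsymbol\varepsilon=(\varepsilon_1,\dots,\varepsilon_\varkappa)\in\{\pm1\}^{\varkappa}$ be arbitrary. Define $|i|\in\mathbb Z/2$ by $s_i=(-1)^{|i|}$, and let $[\cdot,\cdot]$ denote the supercommutator. The super Yangian $\mathscr Y_{\boldsymbol s}=\mathscr Y(\mathfrak{gl}_{m|n}^{\boldsymbol s})$ is the $\mathbb Z/2$-graded unital associative algebra with generators $t_{ij}^{(r)}$ ($1\le i,j\le\varkappa$, $r\ge1$) of parity $|i|+|j|$ and relations $$(u-v)[t_{ij}(u),t_{kl}(v)]=(-1)^{|i||j|+|i||k|+|j||k|}\bigl(t_{kj}(u)t_{il}(v)-t_{kj}(v)t_{il}(u)\bigr),\qquad t_{ij}(u)=\delta_{ij}+\sum_{r\ge1}t_{ij}^{(r)}u^{-r}.$$ The twisted super Yangian $\mathscr B_{\boldsymbol s,\boldsymbol\varepsilon}$ is the $\mathbb Z/2$-graded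 unital associative algebra with generators $b_{ij}^{(r)}$ ($1\le i,j\le\varkappa$, $r\ge1$) of parity $|i|+|j|$ and relations $$\begin{aligned}[b_{ij}(u),b_{kl}(v)]={}&\frac{(-1)^{|i||j|+|i||k|+|j||k|}}{u-v}\bigl(b_{kj}(u)b_{il}(v)-b_{kj}(v)b_{il}(u)\bigr)\\&+\frac{(-1)^{|i||j|+|i||k|+|j||k|}}{u+v}\Bigl(\delta_{kj}\sum_{a}b_{ia}(u)b_{al}(v)-\delta_{il}\sum_{a}b_{ka}(v)b_{aj}(u)\Bigr)\\&-\frac{\delta_{ij}}{u^2-v^2}\Bigl(\sum_{a}b_{ka}(u)b_{al}(v)-\sum_{a}b_{ka}(v)b_{al}(u)\Bigr),\end{aligned}$$ $$\sum_{a}b_{ia}(u)b_{aj}(-u)=\delta_{ij},\qquad b_{ij}(u)=\delta_{ij}\varepsilon_i+\sum_{r\ge1}b_{ij}^{(r)}u^{-r}$$ (the first relation is read after multiplication by $u^2-v^2$, coefficient by coefficient). Write $T(u)=(t_{ij}(u))$, $B(u)=(b_{ij}(u))$ and $G^{\boldsymbol\varepsilon}=\mathrm{diag}(\varepsilon_1,\dots,\varepsilon_\varkappa)$,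 and let $T^{-1}(u)$ be the inverse matrix of $T(u)$ under ordinary matrix multiplication. Equivalently, a matrix $(x_{ij})$ stands for $\sum_{i,j}(-1)^{|i||j|+|j|}x_{ij}\otimes E_{ij}$ in the super tensor product with $\mathrm{End}(\mathbb C^{m|n})$. Then: 1. There is an injective homomorphism of superalgebras $\varphi:\mathscr B_{\boldsymbol s,\boldsymbol\varepsilon}\to\mathscr Y_{\boldsymbol s}$ (that is, a parity-preserving unital algebra homomorphism) which, applied entrywise, satisfies $$\varphi(B(u))=T(u)\,G^{\boldsymbol\varepsilon}\,T^{-1}(-u).$$ 2. Given any total ordering on the generators $b_{ij}^{(2p-1)}$ (for $\varepsilon_i=\varepsilon_j$) and $b_{ij}^{(2p)}$ (for $\varepsilon_i\ne\varepsilon_j$), where $1\le i,j\le\varkappa$ and $p\ge1$, the ordered monomials in these elements containing no second or higher powers of the odd generators form a basis of $\mathscr B_{\boldsymbol s,\boldsymbol\varepsilon}$ over $\mathbb C$. -/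

import Mathlib

open scoped DirectSum

noncomputable section

namespace SuperYangian

/-! ### Superalgebras given by generators with parities and homogeneous relations -/

section Presented

variable {X : Type} (p : X → ZMod 2)

/-- The component of parity `d` of the free algebra on `X`, where `x : X` has parity `p x`:
the span of the words whose letters have parities summing up to `d`. -/
def freeParity (d : ZMod 2) : Submodule ℂ (FreeAlgebra ℂ X) :=
  Submodule.span ℂ {w | ∃ l : List X, (l.map p).sum = d ∧ (l.map (FreeAlgebra.ι ℂ)).prod = w}

theorem freeParity_one : (1 : FreeAlgebra ℂ X) ∈ freeParity p 0 :=
  Submodule.subset_span ⟨[], by simp, by simp⟩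

theorem freeParity_algebraMap (c : ℂ) :
    algebraMap ℂ (FreeAlgebra ℂ X) c ∈ freeParity p 0 := by
  rw [Algebra.algebraMap_eq_smul_one]
  exact Submodule.smul_mem _ _ (freeParity_one p)

theorem freeParity_ι (x : X) : FreeAlgebra.ι ℂ x ∈ freeParity p (p x) :=
  Submodule.subset_span ⟨[x], by simp, by simp⟩

theorem freeParity_mul {a b : ZMod 2} {x y : FreeAlgebra ℂ X}
    (hx : x ∈ freeParity p a) (hy : y ∈ freeParity p b) : x * y ∈ freeParity p (a + b) := by
  have h : freeParity p a * freeParity p b ≤ freeParity p (a + b) := by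
    unfold freeParity
    rw [Submodule.span_mul_span, Submodule.span_le]
    rintro _ ⟨_, ⟨l, hl, rfl⟩, _, ⟨l', hl', rfl⟩, rfl⟩
    exact Submodule.subset_span ⟨l ++ l', by simp [hl, hl'], by simp⟩
  exact h (Submodule.mul_mem_mul hx hy)

variable (r : FreeAlgebra ℂ X → FreeAlgebra ℂ X → Prop)

/-- The component of parity `d` of the algebra with generators `X` and relations `r`. -/
def quotParity (d : ZMod 2) : Submodule ℂ (RingQuot r) :=
  (freeParity p d).map (RingQuot.mkAlgHom ℂ r).toLinearMap

/-- Every relation equates two elements of the same parity. -/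
def HomogeneousRel : Prop :=
  ∀ a b, r a b → ∃ d, a ∈ freeParity p d ∧ b ∈ freeParity p d

instance quotParity_gradedMonoid : SetLike.GradedMonoid (quotParity p r) where
  one_mem := ⟨1, freeParity_one p, by simp⟩
  mul_mem := by
    rintro a b _ _ ⟨x, hx, rfl⟩ ⟨y, hy, rfl⟩
    exact ⟨x * y, freeParity_mul p hx hy, by simp⟩

theorem quotParity_mk {d : ZMod 2} {w : FreeAlgebra ℂ X} (hw : w ∈ freeParity p d) :
    RingQuot.mkAlgHom ℂ r w ∈ quotParity p r d := ⟨w, hw, rfl⟩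

/-- Auxiliary decomposition map, on the free algebra. -/
def freeDecompose : FreeAlgebra ℂ X →ₐ[ℂ] ⨁ d, quotParity p r d :=
  FreeAlgebra.lift ℂ fun x =>
    DirectSum.of (fun d => quotParity p r d) (p x)
      ⟨RingQuot.mkAlgHom ℂ r (FreeAlgebra.ι ℂ x), quotParity_mk p r (freeParity_ι p x)⟩

theorem freeDecompose_eq {d : ZMod 2} {w : FreeAlgebra ℂ X} (hw : w ∈ freeParity p d) :
    freeDecompose p r w = DirectSum.of (fun d => quotParity p r d) d
      ⟨RingQuot.mkAlgHom ℂ r w, quotParity_mk p r hw⟩ := by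
  unfold freeParity at hw
  induction hw using Submodule.span_induction with
  | mem x h =>
    obtain ⟨l, rfl, rfl⟩ := h
    induction l with
    | nil =>
      simp only [List.map_nil, List.prod_nil, map_one]
      rw [DirectSum.one_def]
      rfl
    | cons x l ih =>
      have hl : (l.map (FreeAlgebra.ι ℂ)).prod ∈ freeParity p (l.map p).sum :=
        Submodule.subset_span ⟨l, rfl, rfl⟩
      simp only [List.map_cons, List.prod_cons, map_mul]
      rw [ih]
      unfold freeDecompose
      rw [FreeAlgebra.lift_ι_apply, DirectSum.of_mul_of]
      apply DirectSum.of_eq_of_gradedMonoid_eq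
      refine Sigma.subtype_ext ?_ ?_
      · exact (List.sum_cons (a := p x) (l := l.map p)).symm
      · rfl
  | zero =>
    simp only [map_zero]
    symm
    exact map_zero (DirectSum.of (fun d => quotParity p r d) d)
  | add x y hx hy ihx ihy =>
    rw [map_add, ihx, ihy, ← map_add]
    congr 1
    simp
  | smul c x hx ih =>
    rw [map_smul, ih]
    change c • DirectSum.lof ℂ (ZMod 2) (fun d => quotParity p r d) d _ =
      DirectSum.lof ℂ (ZMod 2) (fun d => quotParity p r d) d _
    rw [← map_smul]
    congr 1
    simp

/-- An algebra presented by generators with parities and by homogeneous relations is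
`ℤ/2`-graded. -/
@[reducible]
def quotGradedAlgebra (h : HomogeneousRel p r) : GradedAlgebra (quotParity p r) :=
  GradedAlgebra.ofAlgHom (quotParity p r)
    (RingQuot.liftAlgHom ℂ ⟨freeDecompose p r, by
      intro a b hab
      obtain ⟨d, ha, hb⟩ := h a b hab
      rw [freeDecompose_eq p r ha, freeDecompose_eq p r hb]
      congr 2
      exact RingQuot.mkAlgHom_rel ℂ hab⟩)
    (by
      apply RingQuot.ringQuot_ext'
      apply FreeAlgebra.hom_ext
      funext x
      simp [freeDecompose])
    (by
      rintro d ⟨_, w, hw, rfl⟩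
      simpa using freeDecompose_eq p r hw)

end Presented

/-! ### Signs, supercommutators and the defining relations -/

section Relations

variable {N : ℕ}

/-- The parity `|i|`, determined by `s i = (-1) ^ |i|`. -/
def parity (s : Fin N → ℤˣ) (i : Fin N) : ZMod 2 := if s i = 1 then 0 else 1

/-- The sign `(-1) ^ a`. -/
def sgn (a : ZMod 2) : ℂ := (-1) ^ a.val

/-- The sign `(-1) ^ (|i||j| + |i||k| + |j||k|)`. -/
def sgn₃ (s : Fin N → ℤˣ) (i j k : Fin N) : ℂ :=
  sgn (parity s i * parity s j + parity s i * parity s k + parity s j * parity s k)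

/-- Generators: `(i, j, r)` stands for the generator with lower indices `i, j` and upper
index `r ≥ 1`. -/
abbrev Gen (N : ℕ) : Type := Fin N × Fin N × ℕ+

/-- The generator `(i, j, r)` has parity `|i| + |j|`. -/
def genParity (s : Fin N → ℤˣ) (g : Gen N) : ZMod 2 := parity s g.1 + parity s g.2.1

/-- The coefficients, at `u ^ (-r)` with `r : ℤ`, of the series
`c i j + ∑_{r ≥ 1} x_{ij}^{(r)} u ^ (-r)`, where `x_{ij}^{(r)}` are the free generators. -/
def freeCoeff (c : Fin N → Fin N → ℂ) (i j : Fin N) (r : ℤ) : FreeAlgebra ℂ (Gen N) :=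
  if h : 0 < r then FreeAlgebra.ι ℂ (i, j, ⟨r.toNat, by omega⟩)
  else if r = 0 then algebraMap ℂ _ (c i j) else 0

variable {A : Type} [Ring A] [Algebra ℂ A]

/-- For `a` of parity `|i| + |j|` and `b` of parity `|k| + |l|`, the supercommutator
`[a, b] = a b - (-1) ^ ((|i| + |j|) (|k| + |l|)) b a`. -/
def superComm (s : Fin N → ℤˣ) (i j k l : Fin N) (a b : A) : A :=
  a * b - sgn ((parity s i + parity s j) * (parity s k + parity s l)) • (b * a)

variable (s : Fin N → ℤˣ) (x : Fin N → Fin N → ℤ → A) (i j k l : Fin N) (p q : ℤ)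

/-! In what follows `x i j r` is the coefficient of `u ^ (-r)` in a series `x_{ij}(u)`. -/

/-- The coefficient of `u ^ (-p) v ^ (-q)` in `[x_{ij}(u), x_{kl}(v)]`. -/
def commCoeff : A := superComm s i j k l (x i j p) (x k l q)

/-- The coefficient of `u ^ (-p) v ^ (-q)` in
`x_{kj}(u) x_{il}(v) - x_{kj}(v) x_{il}(u)`. -/
def exchangeCoeff : A := x k j p * x i l q - x k j q * x i l p

/-- The coefficient of `u ^ (-p) v ^ (-q)` in
`δ_{kj} ∑_a x_{ia}(u) x_{al}(v) - δ_{il} ∑_a x_{ka}(v) x_{aj}(u)`. -/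
def reflectCoeff : A :=
  (if k = j then ∑ a, x i a p * x a l q else 0) - (if i = l then ∑ a, x k a q * x a j p else 0)

/-- The coefficient of `u ^ (-p) v ^ (-q)` in
`δ_{ij} (∑_a x_{ka}(u) x_{al}(v) - ∑_a x_{ka}(v) x_{al}(u))`. -/
def traceCoeff : A :=
  if i = j then (∑ a, x k a p * x a l q) - ∑ a, x k a q * x a l p else 0

/-- The coefficient of `u ^ (-p) v ^ (-q)` in `(u - v) [x_{ij}(u), x_{kl}(v)]`. -/
def rttLHS : A := commCoeff s x i j k l (p + 1) q - commCoeff s x i j k l p (q + 1)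

/-- The coefficient of `u ^ (-p) v ^ (-q)` in
`(-1) ^ (|i||j| + |i||k| + |j||k|) (x_{kj}(u) x_{il}(v) - x_{kj}(v) x_{il}(u))`. -/
def rttRHS : A := sgn₃ s i j k • exchangeCoeff x i j k l p q

/-- The coefficient of `u ^ (-p) v ^ (-q)` in `(u² - v²) [x_{ij}(u), x_{kl}(v)]`. -/
def reflectionLHS : A := commCoeff s x i j k l (p + 2) q - commCoeff s x i j k l p (q + 2)

/-- The coefficient of `u ^ (-p) v ^ (-q)` in `u² - v²` times the right hand side of the
reflection relation, that is, in
`± (u + v) (x_{kj}(u) x_{il}(v) - x_{kj}(v) x_{il}(u))`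
`± (u - v) (δ_{kj} ∑_a x_{ia}(u) x_{al}(v) - δ_{il} ∑_a x_{ka}(v) x_{aj}(u))`
`- δ_{ij} (∑_a x_{ka}(u) x_{al}(v) - ∑_a x_{ka}(v) x_{al}(u))`
with both signs `±` equal to `(-1) ^ (|i||j| + |i||k| + |j||k|)`. -/
def reflectionRHS : A :=
  sgn₃ s i j k • (exchangeCoeff x i j k l (p + 1) q + exchangeCoeff x i j k l p (q + 1)) +
  sgn₃ s i j k • (reflectCoeff x i j k l (p + 1) q - reflectCoeff x i j k l p (q + 1)) -
  traceCoeff x i j k l p q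

/-- The coefficient of `u ^ (-n)` in `∑_a x_{ia}(u) x_{aj}(-u)`. -/
def unitaryLHS (n : ℕ) : A :=
  ∑ a, ∑ d ∈ Finset.HasAntidiagonal.antidiagonal n, ((-1 : ℂ) ^ d.2) • (x i a d.1 * x a j d.2)

end Relations

/-! ### The super Yangian and the twisted super Yangian -/

section Yangians

variable {N : ℕ}

/-- `t_{ij}^{(0)} = δ_{ij}`. -/
def yConst (i j : Fin N) : ℂ := if i = j then 1 else 0

/-- `b_{ij}^{(0)} = δ_{ij} ε_i`. -/
def bConst (ε : Fin N → ℤˣ) (i j : Fin N) : ℂ := if i = j then ((ε i : ℤ) : ℂ) else 0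

/-- Defining relations of the super Yangian: for all `i, j, k, l`, the coefficients of
`(u - v) [t_{ij}(u), t_{kl}(v)]
  = (-1) ^ (|i||j| + |i||k| + |j||k|) (t_{kj}(u) t_{il}(v) - t_{kj}(v) t_{il}(u))`. -/
inductive YangianRel (s : Fin N → ℤˣ) :
    FreeAlgebra ℂ (Gen N) → FreeAlgebra ℂ (Gen N) → Prop
  | rtt (i j k l : Fin N) (p q : ℤ) :
      YangianRel s (rttLHS s (freeCoeff yConst) i j k l p q)
        (rttRHS s (freeCoeff yConst) i j k l p q)

/-- Defining relations of the twisted super Yangian: the reflection relation, multiplied by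
`u² - v²`, and the unitary condition `∑_a b_{ia}(u) b_{aj}(-u) = δ_{ij}`. -/
inductive TwistedRel (s ε : Fin N → ℤˣ) :
    FreeAlgebra ℂ (Gen N) → FreeAlgebra ℂ (Gen N) → Prop
  | reflection (i j k l : Fin N) (p q : ℤ) :
      TwistedRel s ε (reflectionLHS s (freeCoeff (bConst ε)) i j k l p q)
        (reflectionRHS s (freeCoeff (bConst ε)) i j k l p q)
  | unitary (i j : Fin N) (n : ℕ) :
      TwistedRel s ε (unitaryLHS (freeCoeff (bConst ε)) i j n)
        (if n = 0 ∧ i = j then 1 else 0)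

/-- The super Yangian, as an associative algebra. -/
abbrev Yangian (s : Fin N → ℤˣ) : Type := RingQuot (YangianRel s)

/-- The twisted super Yangian, as an associative algebra. -/
abbrev TwistedYangian (s ε : Fin N → ℤˣ) : Type := RingQuot (TwistedRel s ε)

/-- The even (`d = 0`) and odd (`d = 1`) parts of the super Yangian. -/
abbrev yangianParity (s : Fin N → ℤˣ) : ZMod 2 → Submodule ℂ (Yangian s) :=
  quotParity (genParity s) (YangianRel s)

/-- The even (`d = 0`) and odd (`d = 1`) parts of the twisted super Yangian. -/
abbrev twistedParity (s ε : Fin N → ℤˣ) : ZMod 2 → Submodule ℂ (TwistedYangian s ε) :=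
  quotParity (genParity s) (TwistedRel s ε)

/-! The relations are homogeneous, so that both algebras are superalgebras. -/

section Homogeneous

variable (s : Fin N → ℤˣ)

theorem freeCoeff_mem {c : Fin N → Fin N → ℂ} (hc : ∀ i j, i ≠ j → c i j = 0)
    (i j : Fin N) (r : ℤ) :
    freeCoeff c i j r ∈ freeParity (genParity s) (parity s i + parity s j) := by
  unfold freeCoeff
  split_ifs with h h'
  · exact freeParity_ι (genParity s) (i, j, _)
  · by_cases hij : i = j
    · subst hij
      rw [CharTwo.add_self_eq_zero]
      exact freeParity_algebraMap _ _
    · rw [hc i j hij, map_zero]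
      exact Submodule.zero_mem _
  · exact Submodule.zero_mem _

theorem freeCoeff_mul_mem {c : Fin N → Fin N → ℂ} (hc : ∀ i j, i ≠ j → c i j = 0)
    (i j k l : Fin N) (p q : ℤ) {d : ZMod 2}
    (hd : parity s i + parity s j + (parity s k + parity s l) = d) :
    freeCoeff c i j p * freeCoeff c k l q ∈ freeParity (genParity s) d := by
  subst hd
  exact freeParity_mul _ (freeCoeff_mem s hc i j p) (freeCoeff_mem s hc k l q)

theorem sum_mem_aux {c : Fin N → Fin N → ℂ} (hc : ∀ i j, i ≠ j → c i j = 0)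
    (i j : Fin N) (p q : ℤ) :
    ∑ a, freeCoeff c i a p * freeCoeff c a j q ∈
      freeParity (genParity s) (parity s i + parity s j) := by
  refine Submodule.sum_mem _ fun a _ => freeCoeff_mul_mem s hc _ _ _ _ _ _ ?_
  generalize parity s i = x
  generalize parity s j = y
  generalize parity s a = z
  revert x y z
  decide

theorem commCoeff_mem {c : Fin N → Fin N → ℂ} (hc : ∀ i j, i ≠ j → c i j = 0)
    (i j k l : Fin N) (p q : ℤ) :
    commCoeff s (freeCoeff c) i j k l p q ∈ freeParity (genParity s)
      (parity s i + parity s j + (parity s k + parity s l)) :=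
  Submodule.sub_mem _ (freeCoeff_mul_mem s hc _ _ _ _ _ _ rfl)
    (Submodule.smul_mem _ _ (freeCoeff_mul_mem s hc _ _ _ _ _ _ (add_comm _ _)))

theorem exchangeCoeff_mem {c : Fin N → Fin N → ℂ} (hc : ∀ i j, i ≠ j → c i j = 0)
    (i j k l : Fin N) (p q : ℤ) :
    exchangeCoeff (freeCoeff c) i j k l p q ∈ freeParity (genParity s)
      (parity s i + parity s j + (parity s k + parity s l)) :=
  Submodule.sub_mem _ (freeCoeff_mul_mem s hc _ _ _ _ _ _ (by ring))
    (freeCoeff_mul_mem s hc _ _ _ _ _ _ (by ring))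

theorem reflectCoeff_mem {c : Fin N → Fin N → ℂ} (hc : ∀ i j, i ≠ j → c i j = 0)
    (i j k l : Fin N) (p q : ℤ) :
    reflectCoeff (freeCoeff c) i j k l p q ∈ freeParity (genParity s)
      (parity s i + parity s j + (parity s k + parity s l)) := by
  refine Submodule.sub_mem _ ?_ ?_
  · split_ifs with h
    · subst h
      have e : parity s i + parity s k + (parity s k + parity s l) = parity s i + parity s l := by
        generalize parity s i = x
        generalize parity s k = y
        generalize parity s l = z
        revert x y z
        decide
      rw [e]
      exact sum_mem_aux s hc i l p q
    · exact Submodule.zero_mem _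
  · split_ifs with h
    · subst h
      have e : parity s i + parity s j + (parity s k + parity s i) = parity s k + parity s j := by
        generalize parity s i = x
        generalize parity s k = y
        generalize parity s j = z
        revert x y z
        decide
      rw [e]
      exact sum_mem_aux s hc k j q p
    · exact Submodule.zero_mem _

theorem traceCoeff_mem {c : Fin N → Fin N → ℂ} (hc : ∀ i j, i ≠ j → c i j = 0)
    (i j k l : Fin N) (p q : ℤ) :
    traceCoeff (freeCoeff c) i j k l p q ∈ freeParity (genParity s)
      (parity s i + parity s j + (parity s k + parity s l)) := by
  unfold traceCoeff
  split_ifs with h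
  · subst h
    rw [CharTwo.add_self_eq_zero, zero_add]
    exact Submodule.sub_mem _ (sum_mem_aux s hc k l p q) (sum_mem_aux s hc k l q p)
  · exact Submodule.zero_mem _

theorem yConst_diag (i j : Fin N) (h : i ≠ j) : yConst i j = 0 := if_neg h

theorem bConst_diag (ε : Fin N → ℤˣ) (i j : Fin N) (h : i ≠ j) : bConst ε i j = 0 := if_neg h

theorem yangianRel_homogeneous : HomogeneousRel (genParity s) (YangianRel s) := by
  rintro _ _ ⟨i, j, k, l, p, q⟩
  exact ⟨_, Submodule.sub_mem _ (commCoeff_mem s yConst_diag i j k l _ _)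
      (commCoeff_mem s yConst_diag i j k l _ _),
    Submodule.smul_mem _ _ (exchangeCoeff_mem s yConst_diag i j k l _ _)⟩

theorem twistedRel_homogeneous (ε : Fin N → ℤˣ) :
    HomogeneousRel (genParity s) (TwistedRel s ε) := by
  have hc := bConst_diag ε
  rintro _ _ (⟨i, j, k, l, p, q⟩ | ⟨i, j, n⟩)
  · refine ⟨_, Submodule.sub_mem _ (commCoeff_mem s hc i j k l _ _)
      (commCoeff_mem s hc i j k l _ _), Submodule.sub_mem _ (Submodule.add_mem _ ?_ ?_) ?_⟩
    · exact Submodule.smul_mem _ _ (Submodule.add_mem _ (exchangeCoeff_mem s hc i j k l _ _)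
        (exchangeCoeff_mem s hc i j k l _ _))
    · exact Submodule.smul_mem _ _ (Submodule.sub_mem _ (reflectCoeff_mem s hc i j k l _ _)
        (reflectCoeff_mem s hc i j k l _ _))
    · exact traceCoeff_mem s hc i j k l _ _
  · refine ⟨parity s i + parity s j, ?_, ?_⟩
    · refine Submodule.sum_mem _ fun a _ => Submodule.sum_mem _ fun d _ =>
        Submodule.smul_mem _ _ (freeCoeff_mul_mem s hc _ _ _ _ _ _ ?_)
      generalize parity s i = x
      generalize parity s j = y
      generalize parity s a = z
      revert x y z
      decide
    · split_ifs with h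
      · obtain ⟨_, rfl⟩ := h
        rw [CharTwo.add_self_eq_zero]
        exact freeParity_one _
      · exact Submodule.zero_mem _

end Homogeneous

instance yangianGraded (s : Fin N → ℤˣ) : GradedAlgebra (yangianParity s) :=
  quotGradedAlgebra _ _ (yangianRel_homogeneous s)

instance twistedGraded (s ε : Fin N → ℤˣ) : GradedAlgebra (twistedParity s ε) :=
  quotGradedAlgebra _ _ (twistedRel_homogeneous s ε)

/-! ### The matrices `T(u)`, `B(u)` and `G`

Matrices of series in `u⁻¹` are power series, in the variable `u⁻¹`, with matrix coefficients.
A matrix `(x_{ij})` with `x_{ij}` of parity `|i| + |j|` stands for the operator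
`∑ (-1) ^ (|i||j| + |j|) x_{ij} ⊗ E_{ij}`; with these signs the product of operators in the super
tensor product is the ordinary product of matrices, because of `operator_sign_mul`. -/

theorem operator_sign_mul (i j k : ZMod 2) :
    sgn (i * j + j) * sgn (j * k + k) * sgn ((i + j) * (j + k)) = sgn (i * k + k) := by
  have h0 : sgn 0 = 1 := by simp [sgn]
  have h1 : sgn 1 = -1 := by simp [sgn, ZMod.val_one]
  have h2 : (1 : ZMod 2) + 1 = 0 := by decide
  have hz : ∀ z : ZMod 2, z = 0 ∨ z = 1 := by decide
  rcases hz i with rfl | rfl <;> rcases hz j with rfl | rfl <;> rcases hz k with rfl | rfl <;>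
    simp [h0, h1, h2]

/-- `t_{ij}^{(r)}` for `r ≥ 0`, with `t_{ij}^{(0)} = δ_{ij}`. -/
def tCoeff (s : Fin N → ℤˣ) (i j : Fin N) (r : ℕ) : Yangian s :=
  RingQuot.mkAlgHom ℂ (YangianRel s) (freeCoeff yConst i j r)

/-- `b_{ij}^{(r)}` for `r ≥ 0`, with `b_{ij}^{(0)} = δ_{ij} ε_i`. -/
def bCoeff (s ε : Fin N → ℤˣ) (i j : Fin N) (r : ℕ) : TwistedYangian s ε :=
  RingQuot.mkAlgHom ℂ (TwistedRel s ε) (freeCoeff (bConst ε) i j r)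

/-- The matrix `T(u)`. -/
def T (s : Fin N → ℤˣ) : PowerSeries (Matrix (Fin N) (Fin N) (Yangian s)) :=
  PowerSeries.mk fun r => Matrix.of fun i j => tCoeff s i j r

/-- The matrix `B(u)`. -/
def B (s ε : Fin N → ℤˣ) : PowerSeries (Matrix (Fin N) (Fin N) (TwistedYangian s ε)) :=
  PowerSeries.mk fun r => Matrix.of fun i j => bCoeff s ε i j r

/-- The inverse matrix `T⁻¹(u)`; see `T_mul_TInv` and `TInv_mul_T`. -/
def TInv (s : Fin N → ℤˣ) : PowerSeries (Matrix (Fin N) (Fin N) (Yangian s)) :=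
  PowerSeries.invOfUnit (T s) 1

theorem constantCoeff_T (s : Fin N → ℤˣ) : PowerSeries.constantCoeff (T s) = 1 := by
  ext i j
  by_cases h : i = j <;> simp [T, tCoeff, freeCoeff, yConst, Matrix.one_apply, h]

theorem T_mul_TInv (s : Fin N → ℤˣ) : T s * TInv s = 1 :=
  PowerSeries.mul_invOfUnit _ _ (constantCoeff_T s)

theorem TInv_mul_T (s : Fin N → ℤˣ) : TInv s * T s = 1 :=
  PowerSeries.invOfUnit_mul _ _ (constantCoeff_T s)

/-- The substitution `u ↦ -u`. -/
def negArg {A : Type} [Ring A] (f : PowerSeries A) : PowerSeries A :=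
  PowerSeries.mk fun r => (-1) ^ r * PowerSeries.coeff r f

/-- The constant diagonal matrix `G = diag(ε_1, …, ε_N)`. -/
def G (s ε : Fin N → ℤˣ) : PowerSeries (Matrix (Fin N) (Fin N) (Yangian s)) :=
  PowerSeries.C (Matrix.diagonal fun i => ((ε i : ℤ) : Yangian s))

/-- The entrywise application of an algebra homomorphism to a matrix of series. -/
def mapSeries {A A' : Type} [Ring A] [Ring A'] [Algebra ℂ A] [Algebra ℂ A'] (φ : A →ₐ[ℂ] A')
    (f : PowerSeries (Matrix (Fin N) (Fin N) A)) : PowerSeries (Matrix (Fin N) (Fin N) A') :=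
  PowerSeries.mk fun r => (PowerSeries.coeff r f).map φ

/-! ### Ordered monomials -/

/-- The index set of the generators `b_{ij}^{(2p-1)}`, for `ε_i = ε_j`, and `b_{ij}^{(2p)}`,
for `ε_i ≠ ε_j`, where `p ≥ 1`. -/
@[ext]
structure PBWGen (ε : Fin N → ℤˣ) : Type where
  /-- the first lower index -/
  i : Fin N
  /-- the second lower index -/
  j : Fin N
  /-- the upper index -/
  r : ℕ+
  parity_r : (ε i = ε j ∧ Odd (r : ℕ)) ∨ (ε i ≠ ε j ∧ Even (r : ℕ))

/-- Exponents of monomials containing no second or higher powers of odd generators. -/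
abbrev PBWExponent (s ε : Fin N → ℤˣ) : Type :=
  {f : PBWGen ε →₀ ℕ // ∀ g, genParity s (g.i, g.j, g.r) = 1 → f g ≤ 1}

/-- The ordered monomial with exponents `f`: the product of the powers `b_{ij}^{(r)} ^ f (i, j, r)`,
in increasing order of the generators `b_{ij}^{(r)}`. -/
def orderedMonomial (s ε : Fin N → ℤˣ) [LinearOrder (PBWGen ε)] (f : PBWGen ε →₀ ℕ) :
    TwistedYangian s ε :=
  ((f.support.sort (· ≤ ·)).map fun g => bCoeff s ε g.i g.j g.r ^ f g).prod

end Yangians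

end SuperYangian

end

/-!
The homomorphism `phi` exists for a formal reason. In terms of the super permutation `P`, the
relations of the super Yangian say that
`(u - v - P) T₁(u) T₂(v) = T₂(v) T₁(u) (u - v - P)`, and those of the twisted super Yangian say that
`(u - v - P) B₁(u) (u + v - P) B₂(v) = B₂(v) (u + v - P) B₁(u) (u - v - P)` and `B(u) B(-u) = 1`.
The second equation for `B(u) = T(u) G T⁻¹(-u)` follows from the first one, used at the arguments
`(u, v)`, `(v, -u)`, `(-v, -u)` and `(u, -v)`, and from its case `B = G`
(`reflection_of_rtt`, `IsRTT.isReflection`).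

The ordered monomials span (`span_orderedMonomial`) because the twisted super Yangian is filtered
by the sum of the upper indices: unitarity eliminates the generators which are not in the list
(`bInt_mem_weightFilt`), and the reflection relations show that the remaining ones supercommute up
to terms of smaller weight (`commCoeff_mem_weightFilt`). In particular squares of odd generators can
be eliminated.

Linear independence is proved for the images under `phi`, so that it also gives the injectivity of
`phi`, and without using a basis of the super Yangian. Let `V` be the span of `1` and of the
elements `E_{ij} t ^ a` of the matrix current algebra. Left multiplication by
`1 + ∑ (-1) ^ |i| E_{ij} t ^ a u ^ (-a-1)` satisfies the relations of the super Yangian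
(`isRTT_siteSeries`), and the coproduct gives an action on each tensor power of `V` (`rep`). With
`E_{ij} t ^ a` in degree `2 a + 1` and `1` in degree `0`, the element `t_{ij}^{(a+1)}` raises the
degree by at most `2 a + 1`, and its part of exactly this degree creates `E_{ij} t ^ a` in an empty
tensor factor (`repSeries_leading`). The leading part of the image of `b_{ij}^{(a+1)}` is the same
operator times `± (ε_j + (-1) ^ a ε_i)`, which is not zero for the generators in question
(`rep_phi_leading`). Thus a monomial of maximal degree in a linear relation can be isolated: it
creates from the vacuum the state in which its letters fill the tensor factors in order, and among
the monomials of at most this degree no other one does (`perm_of_leadCoeff_ne_zero`,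
`leadCoeff_flatMap`).
-/

noncomputable section

namespace SuperYangian

/-! ### The reflection equation in a ring -/

/-- If `D` and `S` exchange `a, b, ai, bi` as in `h₁`-`h₄`, and the reflection equation holds for
the constants `G₁, G₂`, then it holds for `a * G₁ * ai` and `b * G₂ * bi`. In the application
`D = u - v - P`, `S = u + v - P`, and `a, ai` and `b, bi` are `T(u), T⁻¹(-u)` and `T(v), T⁻¹(-v)`,
acting on the first and on the second tensor factor. -/
theorem reflection_of_exchange {R : Type*} [Ring R]
    {D S a ai b bi G₁ G₂ : R}
    (h₁ : D * a * b = b * a * D) (h₂ : ai * S * b = b * S * ai)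
    (h₃ : D * ai * bi = bi * ai * D) (h₄ : a * S * bi = bi * S * a)
    (hG : D * G₁ * S * G₂ = G₂ * S * G₁ * D)
    (c₁ : Commute G₁ b) (c₂ : Commute G₁ bi) (c₃ : Commute G₂ a) (c₄ : Commute G₂ ai) :
    D * (a * G₁ * ai) * S * (b * G₂ * bi) = b * G₂ * bi * S * (a * G₁ * ai) * D := by
  calc D * (a * G₁ * ai) * S * (b * G₂ * bi)
      = D * a * G₁ * (ai * S * b) * G₂ * bi := by noncomm_ring
    _ = D * a * (G₁ * b) * S * (ai * G₂) * bi := by rw [h₂]; noncomm_ring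
    _ = (D * a * b) * G₁ * S * G₂ * ai * bi := by rw [c₁.eq, ← c₄.eq]; noncomm_ring
    _ = b * a * (D * G₁ * S * G₂) * ai * bi := by rw [h₁]; noncomm_ring
    _ = b * a * G₂ * S * G₁ * (D * ai * bi) := by rw [hG]; noncomm_ring
    _ = b * (a * G₂) * S * (G₁ * bi) * ai * D := by rw [h₃]; noncomm_ring
    _ = b * G₂ * (a * S * bi) * G₁ * ai * D := by rw [← c₃.eq, c₂.eq]; noncomm_ring
    _ = b * G₂ * bi * S * (a * G₁ * ai) * D := by rw [h₄]; noncomm_ring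

/-- The reflection equation for a constant involution `G`: here `P * G * P` is `G` acting on the
first tensor factor. -/
theorem reflection_const {R : Type*} [Ring R] {u v P G : R} (hu : ∀ x, Commute u x)
    (hv : ∀ x, Commute v x) (hP : P * P = 1) (hGG : G * G = 1)
    (hG : Commute (P * G * P) G) :
    (u - v - P) * (P * G * P) * (u + v - P) * G =
      G * (u + v - P) * (P * G * P) * (u - v - P) := by
  have e₁ : (u - v - P) * (P * G * P) * (u + v - P) * G =
      (u - v) * (P * G * P) * (u + v) * G - (u - v) * (P * (G * (P * P)) * G)
        - ((P * P) * (G * P * (u + v) * G)) + (P * P) * G * (P * P) * G := by noncomm_ring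
  have e₂ : G * (u + v - P) * (P * G * P) * (u - v - P) =
      G * (u + v) * (P * G * P) * (u - v) - G * (u + v) * (P * G * (P * P))
        - G * (P * P) * G * P * (u - v) + G * (P * P) * G * (P * P) := by noncomm_ring
  have c₁ : ∀ x, (u - v) * x = x * (u - v) := fun x => ((hu x).sub_left (hv x)).eq
  have c₂ : ∀ x, (u + v) * x = x * (u + v) := fun x => ((hu x).add_left (hv x)).eq
  have hG' : P * G * P * G = G * (P * G * P) := hG
  rw [e₁, e₂]
  simp only [hP, one_mul, mul_one]
  have r₁ : (u - v) * (P * G * P) * (u + v) * G = P * G * P * G * ((u + v) * (u - v)) := by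
    rw [c₁, mul_assoc _ (u - v) (u + v), mul_assoc _ ((u - v) * (u + v)), c₁ (u + v),
      mul_assoc (u + v), c₁ G, ← mul_assoc (u + v), c₂ G]
    simp only [mul_assoc]
  have r₂ : G * (u + v) * (P * G * P) * (u - v) = G * (P * G * P) * ((u + v) * (u - v)) := by
    rw [mul_assoc G, c₂]; simp only [mul_assoc]
  have r₃ : G * P * (u + v) * G = G * P * G * (u + v) := by
    rw [mul_assoc _ (u + v), c₂, ← mul_assoc]
  have r₄ : G * (u + v) * (P * G) = G * P * G * (u + v) := by
    rw [mul_assoc, c₂]; simp only [mul_assoc]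
  have r₅ : (u - v) * (P * G * G) = P * (u - v) := by
    rw [mul_assoc, hGG, mul_one, c₁]
  rw [r₁, r₂, r₃, r₄, r₅, hG', hGG]
  simp only [one_mul]
  abel

/-- The exchange relations for the four pairs of arguments `(u, v)`, `(v, -u)`, `(-v, -u)` and
`(u, -v)` imply the reflection equation. In the application `a, a', ai` are `T(u), T(-u), T⁻¹(-u)`
and `b, b', bi` are `T(v), T(-v), T⁻¹(-v)`, all acting on the second tensor factor, so that
`P * a * P` acts on the first. -/
theorem reflection_of_rtt {R : Type*} [Ring R] {u v P G a a' ai b b' bi : R}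
    (hu : ∀ x, Commute u x) (hv : ∀ x, Commute v x) (hP : P * P = 1) (hGG : G * G = 1)
    (hG : ∀ x, x = G ∨ x = b ∨ x = bi → Commute (P * G * P) x)
    (hG' : ∀ x, x = a ∨ x = ai → Commute (P * G * P) x)
    (ha : a' * ai = 1) (ha' : ai * a' = 1) (hb : b' * bi = 1) (hb' : bi * b' = 1)
    (h₁ : (u - v - P) * (P * a * P) * b = b * (P * a * P) * (u - v - P))
    (h₂ : (u + v - P) * (P * b * P) * a' = a' * (P * b * P) * (u + v - P))
    (h₃ : (u - v - P) * (P * b' * P) * a' = a' * (P * b' * P) * (u - v - P))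
    (h₄ : (u + v - P) * (P * a * P) * b' = b' * (P * a * P) * (u + v - P)) :
    (u - v - P) * (P * (a * G * ai) * P) * (u + v - P) * (b * G * bi) =
      b * G * bi * (u + v - P) * (P * (a * G * ai) * P) * (u - v - P) := by
  have conj : ∀ x y, P * x * P * (P * y * P) = P * (x * y) * P := fun x y => by
    calc P * x * P * (P * y * P) = P * x * (P * P) * y * P := by noncomm_ring
      _ = _ := by rw [hP]; noncomm_ring
  have conj₂ : ∀ x, P * (P * x * P) * P = x := fun x => by
    calc P * (P * x * P) * P = (P * P) * x * (P * P) := by noncomm_ring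
      _ = _ := by rw [hP]; simp
  have conj₃ : ∀ x y z, P * (x * (P * y * P) * z) * P = P * x * P * y * (P * z * P) := by
    intro x y z
    noncomm_ring
  -- `u ± v - P` is fixed under conjugation by `P`
  have hPD : ∀ w, (∀ x, Commute w x) → P * (w - P) * P = w - P := fun w hw => by
    rw [mul_sub, sub_mul, mul_assoc P w, (hw P).eq, ← mul_assoc, hP]; simp
  have hD := hPD (u - v) fun x => (hu x).sub_left (hv x)
  have hS := hPD (u + v) fun x => (hu x).add_left (hv x)
  set D := u - v - P with hD'
  set S := u + v - P with hS'
  set A := P * a' * P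
  set Ai := P * ai * P
  have hA : A * Ai = 1 := by rw [conj, ha]; simp [hP]
  have hA' : Ai * A = 1 := by rw [conj, ha']; simp [hP]
  -- `h₂` and `h₃` with the two tensor factors interchanged
  have g₂ : S * b * A = A * b * S := by
    have := congrArg (fun x => P * x * P) h₂
    rwa [conj₃, conj₃, hS] at this
  have g₃ : D * b' * A = A * b' * D := by
    have := congrArg (fun x => P * x * P) h₃
    rwa [conj₃, conj₃, hD] at this
  have e : P * (a * G * ai) * P = (P * a * P) * (P * G * P) * Ai := by rw [conj, conj]
  rw [e]
  refine reflection_of_exchange h₁ ?_ ?_ ?_ (reflection_const hu hv hP hGG (hG _ (.inl rfl)))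
    (hG _ (.inr (.inl rfl))) (hG _ (.inr (.inr rfl))) ?_ ?_
  · calc Ai * S * b = Ai * (S * b * A) * Ai := by
          simp only [mul_assoc, hA, mul_one]
      _ = (Ai * A) * b * S * Ai := by rw [g₂]; noncomm_ring
      _ = _ := by rw [hA', one_mul]
  · calc D * Ai * bi = bi * Ai * (A * b' * D) * Ai * bi := by
          rw [show bi * Ai * (A * b' * D) * Ai * bi = bi * (Ai * A) * b' * D * Ai * bi by
            noncomm_ring, hA', mul_one, hb', one_mul]
      _ = bi * Ai * D * b' * (A * Ai) * bi := by rw [← g₃]; noncomm_ring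
      _ = _ := by rw [hA, mul_one, mul_assoc _ b', hb, mul_one]
  · calc P * a * P * S * bi = bi * (b' * (P * a * P) * S) * bi := by
          simp only [← mul_assoc, hb', one_mul]
      _ = bi * S * (P * a * P) * (b' * bi) := by rw [← h₄]; noncomm_ring
      _ = _ := by rw [hb, mul_one]
  · have := congrArg (fun x => P * x * P) (hG' _ (.inl rfl)).eq
    rwa [← conj, conj₂, ← conj, conj₂] at this
  · have := congrArg (fun x => P * x * P) (hG' _ (.inr rfl)).eq
    rwa [← conj, conj₂, ← conj, conj₂] at this

/-- The exchange relations for `x` and `y` imply those for the product `x * y`, provided that `x` on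
one tensor factor commutes with `y` on the other. -/
theorem rtt_mul {R : Type*} [Ring R] {D P xu yu xv yv : R} (hP : P * P = 1)
    (hx : D * (P * xu * P) * xv = xv * (P * xu * P) * D)
    (hy : D * (P * yu * P) * yv = yv * (P * yu * P) * D)
    (hxy : Commute (P * xu * P) yv) (hyx : Commute (P * yu * P) xv) :
    D * (P * (xu * yu) * P) * (xv * yv) = xv * yv * (P * (xu * yu) * P) * D := by
  have e : P * (xu * yu) * P = P * xu * P * (P * yu * P) := by
    calc P * (xu * yu) * P = P * xu * 1 * yu * P := by noncomm_ring
      _ = _ := by rw [← hP]; noncomm_ring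
  rw [e]
  set X := P * xu * P
  set Y := P * yu * P
  calc D * (X * Y) * (xv * yv) = D * X * (Y * xv) * yv := by noncomm_ring
    _ = (D * X * xv) * Y * yv := by rw [hyx.eq]; noncomm_ring
    _ = xv * X * (D * Y * yv) := by rw [hx]; noncomm_ring
    _ = xv * (X * yv) * Y * D := by rw [hy]; noncomm_ring
    _ = _ := by rw [hxy.eq]; noncomm_ring

/-! ### Operators on the two-fold tensor power -/

/-!
Operators on `A ⊗ ℂ^{m|n} ⊗ ℂ^{m|n}` are written as matrices over `A` with rows and columns indexed
by pairs `(k, i)`, where `k` belongs to the *second* and `i` to the first copy of `ℂ^{m|n}`. An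
operator on the second copy is then block diagonal without signs; all signs are those of the super
permutation.
-/

section Signs

theorem sgn_add (a b : ZMod 2) : sgn (a + b) = sgn a * sgn b := by
  have h0 : sgn 0 = 1 := by simp [sgn]
  have h1 : sgn 1 = -1 := by simp [sgn, ZMod.val_one]
  have h2 : (1 : ZMod 2) + 1 = 0 := by decide
  have hz : ∀ z : ZMod 2, z = 0 ∨ z = 1 := by decide
  rcases hz a with rfl | rfl <;> rcases hz b with rfl | rfl <;> simp [h0, h1, h2]

@[simp] theorem sgn_mul_self (a : ZMod 2) : sgn a * sgn a = 1 := by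
  rw [← sgn_add, CharTwo.add_self_eq_zero]
  simp [sgn]

@[simp] theorem sgn_zero : sgn 0 = 1 := by simp [sgn]

theorem sgn_ne_zero (a : ZMod 2) : sgn a ≠ 0 := fun h => by
  have := sgn_mul_self a
  simp [h] at this

end Signs

variable {N : ℕ} {A : Type} [Ring A] [Algebra ℂ A]

/-- A matrix over `A`, as an operator on the second tensor factor. -/
def onSecond : Matrix (Fin N) (Fin N) A →+*
    Matrix (Fin N × Fin N) (Fin N × Fin N) A :=
  (Matrix.blockDiagonalRingHom (Fin N) (Fin N) A).comp
    (Pi.constRingHom (Fin N) (Matrix (Fin N) (Fin N) A))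

omit [Algebra ℂ A] in
theorem onSecond_apply (x : Matrix (Fin N) (Fin N) A) (k i l j : Fin N) :
    onSecond x (k, i) (l, j) = if i = j then x k l else 0 := by
  simp [onSecond, Matrix.blockDiagonal_apply]

/-- The super permutation: it interchanges the tensor factors, with the sign `(-1) ^ (|i||j|)`. -/
def superPerm (A : Type) [Ring A] [Algebra ℂ A] (s : Fin N → ℤˣ) :
    Matrix (Fin N × Fin N) (Fin N × Fin N) A :=
  Matrix.of fun a b => if b = (a.2, a.1) then algebraMap ℂ A (sgn (parity s a.1 * parity s a.2))
    else 0

variable (s : Fin N → ℤˣ)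

theorem superPerm_mul (Z : Matrix (Fin N × Fin N) (Fin N × Fin N) A) (k i : Fin N)
    (b : Fin N × Fin N) :
    (superPerm A s * Z) (k, i) b = sgn (parity s k * parity s i) • Z (i, k) b := by
  simp [superPerm, Matrix.mul_apply, Algebra.smul_def]

theorem mul_superPerm (Z : Matrix (Fin N × Fin N) (Fin N × Fin N) A) (l j : Fin N)
    (a : Fin N × Fin N) :
    (Z * superPerm A s) a (l, j) = sgn (parity s l * parity s j) • Z a (j, l) := by
  rw [Matrix.mul_apply, Finset.sum_eq_single (j, l)]
  · simp only [superPerm, Matrix.of_apply, if_true, Algebra.smul_def,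
      Algebra.commutes, mul_comm]
  · rintro ⟨c, d⟩ - h
    have : (l, j) ≠ (d, c) := by
      rintro h'
      simp_all
    simp [superPerm, this]
  · simp

theorem superPerm_mul_self : superPerm A s * superPerm A s = 1 := by
  ext ⟨k, i⟩ ⟨l, j⟩
  rw [superPerm_mul]
  simp only [superPerm, Matrix.of_apply, Matrix.one_apply, Prod.mk.injEq]
  by_cases h : l = k ∧ j = i
  · obtain ⟨rfl, rfl⟩ := h
    rw [Algebra.smul_def]
    simp only [and_self, if_true, ← map_mul]
    rw [mul_comm (parity s j), sgn_mul_self, map_one]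
  · rw [if_neg h, if_neg (by tauto), smul_zero]

section Entries

variable (x y : Matrix (Fin N) (Fin N) A) (i j k l : Fin N)

/-- Conjugation by the super permutation turns an operator on the second tensor factor into one on
the first. -/
theorem first_apply :
    (superPerm A s * onSecond x * superPerm A s) (k, i) (l, j) =
      if k = l then sgn (parity s k * (parity s i + parity s j)) • x i j else 0 := by
  rw [mul_superPerm, superPerm_mul, onSecond_apply]
  split_ifs with h
  · subst h
    rw [smul_smul, ← sgn_add]
    congr 2
    ring
  · simp

theorem first_mul_second_apply :
    (superPerm A s * onSecond x * superPerm A s * onSecond y) (k, i) (l, j) =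
      sgn (parity s k * (parity s i + parity s j)) • (x i j * y k l) := by
  rw [Matrix.mul_apply, Finset.sum_eq_single (k, j)]
  · rw [first_apply, onSecond_apply]
    simp
  · rintro ⟨c, d⟩ - h
    rw [first_apply, onSecond_apply]
    by_cases h1 : k = c
    · by_cases h2 : d = j
      · simp_all
      · simp [h2]
    · simp [h1]
  · simp

theorem second_mul_first_apply :
    (onSecond y * (superPerm A s * onSecond x * superPerm A s)) (k, i) (l, j) =
      sgn (parity s l * (parity s i + parity s j)) • (y k l * x i j) := by
  rw [Matrix.mul_apply, Finset.sum_eq_single (l, i)]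
  · rw [first_apply, onSecond_apply]
    simp
  · rintro ⟨c, d⟩ - h
    rw [first_apply, onSecond_apply]
    by_cases h1 : c = l
    · by_cases h2 : i = d
      · simp_all
      · simp [h2]
    · simp [h1]
  · simp

theorem second_perm_second_apply :
    (onSecond x * superPerm A s * onSecond y) (k, i) (l, j) =
      sgn (parity s i * parity s j) • (x k j * y i l) := by
  rw [mul_assoc, Matrix.mul_apply, Finset.sum_eq_single (j, i)]
  · rw [superPerm_mul, onSecond_apply, onSecond_apply]
    simp [mul_comm]
  · rintro ⟨c, d⟩ - h
    rw [superPerm_mul, onSecond_apply, onSecond_apply]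
    by_cases h1 : c = j
    · by_cases h2 : i = d
      · simp_all
      · simp [h2]
    · simp [h1]
  · simp

theorem perm_second_apply :
    (superPerm A s * onSecond x) (k, i) (l, j) =
      if k = j then sgn (parity s k * parity s i) • x i l else 0 := by
  rw [superPerm_mul, onSecond_apply]
  split_ifs <;> simp

theorem second_perm_apply :
    (onSecond x * superPerm A s) (k, i) (l, j) =
      if i = l then sgn (parity s i * parity s j) • x k j else 0 := by
  rw [mul_superPerm, onSecond_apply]
  split_ifs with h
  · rw [h]
  · simp

end Entries

/-! ### Series in two variables -/

section TwoVariables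

open HahnSeries

variable {R : Type} [Ring R]

/-- The coefficient of `u ^ (-r)`, for an integer `r`, of a power series in `u⁻¹`. -/
def intCoeff (f : PowerSeries R) (r : ℤ) : R :=
  if 0 ≤ r then PowerSeries.coeff r.toNat f else 0

theorem intCoeff_natCast (f : PowerSeries R) (n : ℕ) : intCoeff f n = PowerSeries.coeff n f := by
  simp [intCoeff]

theorem intCoeff_of_neg (f : PowerSeries R) {r : ℤ} (h : r < 0) : intCoeff f r = 0 := by
  simp [intCoeff, h]

theorem ofPowerSeries_coeff_int (f : PowerSeries R) (r : ℤ) :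
    (ofPowerSeries ℤ R f).coeff r = intCoeff f r := by
  rcases lt_or_ge r 0 with h | h
  · rw [intCoeff_of_neg f h, ofPowerSeries_apply, embDomain_of_notMem_range]
    rintro ⟨n, rfl⟩
    exact absurd h (not_lt.mpr (Int.natCast_nonneg n))
  · lift r to ℕ using h
    rw [intCoeff_natCast]
    exact ofPowerSeries_apply_coeff f r

theorem intCoeff_map {R' : Type} [Ring R'] (g : R →+* R') (f : PowerSeries R) (r : ℤ) :
    intCoeff (PowerSeries.map g f) r = g (intCoeff f r) := by
  unfold intCoeff
  split_ifs <;> simp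

/-- Series in `u⁻¹` and `v⁻¹`, Laurent in both variables: the outer variable is `u`. -/
abbrev TwoVar (R : Type) [Ring R] : Type := HahnSeries ℤ (HahnSeries ℤ R)

/-- The coefficient of `u ^ (-p) v ^ (-q)`. -/
def coeff₂ (p q : ℤ) : TwoVar R →+ R where
  toFun f := (f.coeff p).coeff q
  map_zero' := by simp
  map_add' := by simp

theorem TwoVar.ext {f g : TwoVar R} (h : ∀ p q, coeff₂ p q f = coeff₂ p q g) : f = g := by
  ext p q
  exact h p q

/-- The variable `u`. -/
def varU : TwoVar R := single (-1) 1

/-- The variable `v`. -/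
def varV : TwoVar R := C (single (-1) 1)

/-- The constant series. -/
def const₂ : R →+* TwoVar R := (C : HahnSeries ℤ R →+* TwoVar R).comp C

/-- The substitution of `u` into a power series. -/
def atU : PowerSeries R →+* TwoVar R :=
  (ofPowerSeries ℤ (HahnSeries ℤ R)).comp (PowerSeries.map C)

/-- The substitution of `v` into a power series. -/
def atV : PowerSeries R →+* TwoVar R :=
  (C : HahnSeries ℤ R →+* TwoVar R).comp (ofPowerSeries ℤ R)

theorem varU_comm (f : TwoVar R) : Commute varU f := by
  refine TwoVar.ext fun p q => ?_
  simp [coeff₂, varU, coeff_single_mul, coeff_mul_single]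

theorem varV_comm (f : TwoVar R) : Commute varV f := by
  refine TwoVar.ext fun p q => ?_
  simp [coeff₂, varV, coeff_single_mul, coeff_mul_single, C_apply]

theorem coeff₂_varU_mul (f : TwoVar R) (p q : ℤ) :
    coeff₂ p q (varU * f) = coeff₂ (p + 1) q f := by
  simp [coeff₂, varU, coeff_single_mul]

theorem coeff₂_varV_mul (f : TwoVar R) (p q : ℤ) :
    coeff₂ p q (varV * f) = coeff₂ p (q + 1) f := by
  simp [coeff₂, varV, coeff_single_mul, C_apply]

theorem coeff₂_const_mul (c : R) (f : TwoVar R) (p q : ℤ) :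
    coeff₂ p q (const₂ c * f) = c * coeff₂ p q f := by
  simp [coeff₂, const₂, C_apply]

theorem coeff₂_mul_const (c : R) (f : TwoVar R) (p q : ℤ) :
    coeff₂ p q (f * const₂ c) = coeff₂ p q f * c := by
  simp [coeff₂, const₂, C_apply]

theorem atU_coeff (f : PowerSeries R) (p : ℤ) : (atU f).coeff p = C (intCoeff f p) := by
  simp only [atU, RingHom.comp_apply, ofPowerSeries_coeff_int, intCoeff_map]

theorem coeff₂_atU_mul_atV (c : R) (f g : PowerSeries R) (p q : ℤ) :
    coeff₂ p q (atU f * const₂ c * atV g) = intCoeff f p * c * intCoeff g q := by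
  simp only [coeff₂, AddMonoidHom.coe_mk, ZeroHom.coe_mk, atV, const₂, RingHom.comp_apply]
  simp [C_apply, atU_coeff, ofPowerSeries_coeff_int]

theorem coeff₂_atV_mul_atU (c : R) (f g : PowerSeries R) (p q : ℤ) :
    coeff₂ p q (atV g * const₂ c * atU f) = intCoeff g q * c * intCoeff f p := by
  simp only [coeff₂, AddMonoidHom.coe_mk, ZeroHom.coe_mk, atV, const₂, RingHom.comp_apply]
  rw [← map_mul]
  simp [C_apply, atU_coeff, ofPowerSeries_coeff_int]

/-- A ring `R` of series in two central variables `x` and `y` over `S`, described by its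
coefficients: `cf p q f` is the coefficient of `x ^ (-p) y ^ (-q)` in `f`, and a power series over
`S` is a series in the inverse of either variable. The two instances `substUV` and `substVU` treat
both orders of the variables at once. -/
structure Substitution (S R : Type) [Ring S] [Ring R] where
  /-- the first variable -/
  x : R
  /-- the second variable -/
  y : R
  /-- the constant series -/
  const : S →+* R
  /-- the substitution of the first variable into a power series -/
  X : PowerSeries S →+* R
  /-- the substitution of the second variable into a power series -/
  Y : PowerSeries S →+* R
  /-- the coefficients -/
  cf : ℤ → ℤ → R →+ S
  x_comm : ∀ f, Commute x f
  y_comm : ∀ f, Commute y f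
  ext : ∀ f g, (∀ p q, cf p q f = cf p q g) → f = g
  cf_x_mul : ∀ p q f, cf p q (x * f) = cf (p + 1) q f
  cf_y_mul : ∀ p q f, cf p q (y * f) = cf p (q + 1) f
  cf_const_mul : ∀ p q c f, cf p q (const c * f) = c * cf p q f
  cf_mul_const : ∀ p q c f, cf p q (f * const c) = cf p q f * c
  cf_X_mul_Y : ∀ p q f c g, cf p q (X f * const c * Y g) = intCoeff f p * c * intCoeff g q
  cf_Y_mul_X : ∀ p q f c g, cf p q (Y g * const c * X f) = intCoeff g q * c * intCoeff f p

/-- Series in `u⁻¹` and `v⁻¹`, with first variable `u` and second variable `v`. -/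
def substUV (S : Type) [Ring S] : Substitution S (TwoVar S) where
  x := varU
  y := varV
  const := const₂
  X := atU
  Y := atV
  cf := coeff₂
  x_comm := varU_comm
  y_comm := varV_comm
  ext _ _ := TwoVar.ext
  cf_x_mul _ _ _ := coeff₂_varU_mul _ _ _
  cf_y_mul _ _ _ := coeff₂_varV_mul _ _ _
  cf_const_mul _ _ _ _ := coeff₂_const_mul _ _ _ _
  cf_mul_const _ _ _ _ := coeff₂_mul_const _ _ _ _
  cf_X_mul_Y _ _ _ _ _ := coeff₂_atU_mul_atV _ _ _ _ _
  cf_Y_mul_X _ _ _ _ _ := coeff₂_atV_mul_atU _ _ _ _ _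

/-- Series in `u⁻¹` and `v⁻¹`, with first variable `v` and second variable `u`. -/
def substVU (S : Type) [Ring S] : Substitution S (TwoVar S) where
  x := varV
  y := varU
  const := const₂
  X := atV
  Y := atU
  cf p q := coeff₂ q p
  x_comm := varV_comm
  y_comm := varU_comm
  ext _ _ h := TwoVar.ext fun p q => h q p
  cf_x_mul _ _ _ := coeff₂_varV_mul _ _ _
  cf_y_mul _ _ _ := coeff₂_varU_mul _ _ _
  cf_const_mul _ _ _ _ := coeff₂_const_mul _ _ _ _
  cf_mul_const _ _ _ _ := coeff₂_mul_const _ _ _ _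
  cf_X_mul_Y _ _ _ _ _ := coeff₂_atV_mul_atU _ _ _ _ _
  cf_Y_mul_X _ _ _ _ _ := coeff₂_atU_mul_atV _ _ _ _ _

end TwoVariables

/-! ### Expanded forms of the exchange and reflection equations -/

section ExchangeForm

/-- With the central element `z = u - v`, the exchange relation says that `(u - v) [x₁, y₂]` is
`x₂ P y₂ - y₂ P x₂`. -/
theorem exchange_iff {R : Type*} [Ring R] {z P x y : R} (hz : ∀ w, Commute z w) (hP : P * P = 1) :
    (z - P) * (P * x * P) * y = y * (P * x * P) * (z - P) ↔
      z * (P * x * P * y - y * (P * x * P)) = x * P * y - y * P * x := by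
  have e₁ : (z - P) * (P * x * P) * y = z * (P * x * P * y) - x * P * y := by
    calc _ = z * (P * x * P * y) - P * P * x * P * y := by noncomm_ring
      _ = _ := by rw [hP, one_mul]
  have e₂ : y * (P * x * P) * (z - P) = z * (y * (P * x * P)) - y * P * x := by
    calc _ = y * (P * x * P) * z - y * P * x * (P * P) := by noncomm_ring
      _ = _ := by rw [hP, mul_one, (hz _).eq]
  rw [e₁, e₂, mul_sub, sub_eq_sub_iff_sub_eq_sub]

/-- The reflection equation, expanded as `(u² - v²) [x₁, y₂] = …`. -/
theorem reflection_iff {R : Type*} [Ring R] {u v P x y : R} (hu : ∀ w, Commute u w)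
    (hv : ∀ w, Commute v w) (hP : P * P = 1) :
    (u - v - P) * (P * x * P) * (u + v - P) * y = y * (u + v - P) * (P * x * P) * (u - v - P) ↔
      u * (u * (P * x * P * y - y * (P * x * P))) - v * (v * (P * x * P * y - y * (P * x * P))) =
        (u + v) * (x * P * y - y * P * x) + (u - v) * (P * (x * y) - y * x * P)
          - (x * y - y * x) := by
  have c₁ : ∀ x, x * (u - v) = (u - v) * x := fun x => ((hu x).sub_left (hv x)).eq.symm
  have c₂ : ∀ x, x * (u + v) = (u + v) * x := fun x => ((hu x).add_left (hv x)).eq.symm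
  have e₁ : (u - v - P) * (P * x * P) * (u + v - P) * y =
      (u - v) * (u + v) * (P * x * P * y) - (u - v) * (P * (x * y))
        - (u + v) * (x * P * y) + x * y := by
    calc _ = (u - v) * (P * x * P * (u + v)) * y - (u - v) * (P * x * (P * P) * y)
        - ((P * P) * x * P * (u + v)) * y + (P * P) * x * (P * P) * y := by noncomm_ring
      _ = _ := by rw [hP, c₂, c₂]; simp only [mul_one, one_mul, mul_assoc]
  have e₂ : y * (u + v - P) * (P * x * P) * (u - v - P) =
      (u - v) * (u + v) * (y * (P * x * P)) - (u + v) * (y * P * x)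
        - (u - v) * (y * x * P) + y * x := by
    calc _ = (y * (u + v)) * (P * x * P) * (u - v) - (y * (u + v)) * (P * x * (P * P))
        - y * (P * P) * x * P * (u - v) + y * (P * P) * x * (P * P) := by noncomm_ring
      _ = _ := by rw [hP, c₁, c₁, c₂]; simp only [mul_one, mul_assoc]
  have e₃ : (u - v) * (u + v) = u * u - v * v := by
    rw [sub_mul, mul_add, mul_add, (hu v).eq]; abel
  rw [e₁, e₂, e₃, ← sub_eq_zero, ← sub_eq_zero (b := _ - (x * y - y * x))]
  refine Iff.of_eq (congrArg (· = 0) ?_)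
  simp only [mul_sub, sub_mul, mul_assoc]
  abel

end ExchangeForm

/-! ### Exchange and reflection relations of series of matrices -/

variable {N : ℕ} {A : Type} [Ring A] [Algebra ℂ A]

/-- The entries of the integer coefficients of a series of matrices. -/
def entries (F : PowerSeries (Matrix (Fin N) (Fin N) A)) (i j : Fin N) (r : ℤ) : A :=
  intCoeff F r i j

/-- The defining relations of the super Yangian hold for the entries of `F`. -/
def IsRTT (s : Fin N → ℤˣ) (F : PowerSeries (Matrix (Fin N) (Fin N) A)) : Prop :=
  ∀ i j k l p q, rttLHS s (entries F) i j k l p q = rttRHS s (entries F) i j k l p q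

/-- The reflection relations of the twisted super Yangian hold for the entries of `F`. -/
def IsReflection (s : Fin N → ℤˣ) (F : PowerSeries (Matrix (Fin N) (Fin N) A)) : Prop :=
  ∀ i j k l p q, reflectionLHS s (entries F) i j k l p q = reflectionRHS s (entries F) i j k l p q

variable {s : Fin N → ℤˣ}

theorem supercomm_first_second_apply (x y : Matrix (Fin N) (Fin N) A) (i j k l : Fin N) :
    (superPerm A s * onSecond x * superPerm A s * onSecond y -
        onSecond y * (superPerm A s * onSecond x * superPerm A s)) (k, i) (l, j) =
      sgn (parity s k * (parity s i + parity s j)) •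
        superComm s i j k l (x i j) (y k l) := by
  rw [Matrix.sub_apply, first_mul_second_apply, second_mul_first_apply, superComm, smul_sub,
    smul_smul, ← sgn_add]
  have h : ∀ i j k l : ZMod 2, k * (i + j) + (i + j) * (k + l) = l * (i + j) := by decide
  rw [h]

theorem exchange_apply (x y : Matrix (Fin N) (Fin N) A) (i j k l : Fin N) :
    (onSecond x * superPerm A s * onSecond y - onSecond y * superPerm A s * onSecond x)
        (k, i) (l, j) =
      sgn (parity s k * (parity s i + parity s j)) • sgn₃ s i j k •
        (x k j * y i l - y k j * x i l) := by
  rw [Matrix.sub_apply, second_perm_second_apply, second_perm_second_apply, ← smul_sub,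
    sgn₃, smul_smul, ← sgn_add]
  have h : ∀ i j k : ZMod 2, i * j = k * (i + j) + (i * j + i * k + j * k) := by decide
  rw [← h]

theorem reflect_apply (x y : Matrix (Fin N) (Fin N) A) (i j k l : Fin N) :
    (superPerm A s * (onSecond x * onSecond y) - onSecond y * onSecond x * superPerm A s)
        (k, i) (l, j) =
      sgn (parity s k * (parity s i + parity s j)) • sgn₃ s i j k •
        ((if k = j then (x * y) i l else 0) - (if i = l then (y * x) k j else 0)) := by
  have h : ∀ i j k : ZMod 2, k * (i + j) + (i * j + i * k + j * k) = i * j := by decide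
  rw [← map_mul, ← map_mul, Matrix.sub_apply, perm_second_apply, second_perm_apply, sgn₃, smul_smul,
    ← sgn_add, h, smul_sub, smul_ite, smul_ite, smul_zero]
  congr 1
  split_ifs with h
  · rw [h, mul_comm]
  · rfl

theorem trace_apply (x y : Matrix (Fin N) (Fin N) A) (i j k l : Fin N) :
    (onSecond x * onSecond y - onSecond y * onSecond x) (k, i) (l, j) =
      sgn (parity s k * (parity s i + parity s j)) •
        (if i = j then (x * y) k l - (y * x) k l else 0) := by
  rw [← map_mul, ← map_mul, ← map_sub, onSecond_apply, smul_ite, smul_zero]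
  split_ifs with h
  · rw [h, CharTwo.add_self_eq_zero, mul_zero, sgn_zero, one_smul, Matrix.sub_apply]
  · rfl

/-- The relations of the super Yangian, collected in identities of operators: at the entry
`(k, i), (l, j)` these are the relations for `i, j, k, l` times a sign. -/
theorem isRTT_iff_coeff (F : PowerSeries (Matrix (Fin N) (Fin N) A)) :
    IsRTT s F ↔ ∀ p q,
      (superPerm A s * onSecond (intCoeff F (p + 1)) * superPerm A s * onSecond (intCoeff F q) -
        onSecond (intCoeff F q) *
          (superPerm A s * onSecond (intCoeff F (p + 1)) * superPerm A s)) -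
      (superPerm A s * onSecond (intCoeff F p) * superPerm A s * onSecond (intCoeff F (q + 1)) -
        onSecond (intCoeff F (q + 1)) *
          (superPerm A s * onSecond (intCoeff F p) * superPerm A s)) =
      onSecond (intCoeff F p) * superPerm A s * onSecond (intCoeff F q) -
        onSecond (intCoeff F q) * superPerm A s * onSecond (intCoeff F p) := by
  have key : ∀ i j k l p q,
      (rttLHS s (entries F) i j k l p q = rttRHS s (entries F) i j k l p q ↔
        sgn (parity s k * (parity s i + parity s j)) • rttLHS s (entries F) i j k l p q =
          sgn (parity s k * (parity s i + parity s j)) • rttRHS s (entries F) i j k l p q) :=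
    fun i j k l p q => (smul_right_injective A (sgn_ne_zero _)).eq_iff.symm
  constructor
  · intro h p q
    ext ⟨k, i⟩ ⟨l, j⟩
    rw [Matrix.sub_apply, supercomm_first_second_apply, supercomm_first_second_apply,
      exchange_apply, ← smul_sub]
    exact (key i j k l p q).1 (h i j k l p q)
  · intro h i j k l p q
    have := congrFun (congrFun (h p q) (k, i)) (l, j)
    rw [Matrix.sub_apply, supercomm_first_second_apply, supercomm_first_second_apply,
      exchange_apply, ← smul_sub] at this
    exact (key i j k l p q).2 this

section Substituted

variable {R : Type} [Ring R] (σ : Substitution (Matrix (Fin N × Fin N) (Fin N × Fin N) A) R)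

/-- The series of operators `F(x)`, acting on the second tensor factor. -/
def Substitution.secondX : PowerSeries (Matrix (Fin N) (Fin N) A) →+* R :=
  σ.X.comp (PowerSeries.map onSecond)

/-- The series of operators `F(y)`, acting on the second tensor factor. -/
def Substitution.secondY : PowerSeries (Matrix (Fin N) (Fin N) A) →+* R :=
  σ.Y.comp (PowerSeries.map onSecond)

/-- The super permutation, as a constant series. -/
def Substitution.perm (s : Fin N → ℤˣ) : R := σ.const (superPerm A s)

theorem perm_mul_self : σ.perm s * σ.perm s = 1 := by
  rw [Substitution.perm, ← map_mul, superPerm_mul_self, map_one]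

theorem cf_supercomm (F G : PowerSeries (Matrix (Fin N) (Fin N) A)) (p q : ℤ) :
    σ.cf p q (σ.perm s * σ.secondX F * σ.perm s * σ.secondY G -
      σ.secondY G * (σ.perm s * σ.secondX F * σ.perm s)) =
      superPerm A s * onSecond (intCoeff F p) * superPerm A s * onSecond (intCoeff G q) -
        onSecond (intCoeff G q) *
          (superPerm A s * onSecond (intCoeff F p) * superPerm A s) := by
  rw [map_sub, Substitution.perm, Substitution.secondX, Substitution.secondY,
    RingHom.comp_apply, RingHom.comp_apply, mul_assoc (σ.const (superPerm A s)),
    mul_assoc (σ.const (superPerm A s)), σ.cf_const_mul, σ.cf_X_mul_Y,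
    ← mul_assoc (σ.Y _), ← mul_assoc (σ.Y _ * _), σ.cf_mul_const, σ.cf_Y_mul_X,
    intCoeff_map, intCoeff_map]
  simp only [mul_assoc]

theorem cf_exchange (F G : PowerSeries (Matrix (Fin N) (Fin N) A)) (p q : ℤ) :
    σ.cf p q (σ.secondX F * σ.perm s * σ.secondY G - σ.secondY G * σ.perm s * σ.secondX F) =
      onSecond (intCoeff F p) * superPerm A s * onSecond (intCoeff G q) -
        onSecond (intCoeff G q) * superPerm A s * onSecond (intCoeff F p) := by
  rw [map_sub, Substitution.perm, Substitution.secondX, Substitution.secondY,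
    RingHom.comp_apply, RingHom.comp_apply, σ.cf_X_mul_Y, σ.cf_Y_mul_X,
    intCoeff_map, intCoeff_map]

theorem cf_reflect (F G : PowerSeries (Matrix (Fin N) (Fin N) A)) (p q : ℤ) :
    σ.cf p q (σ.perm s * (σ.secondX F * σ.secondY G) -
        σ.secondY G * σ.secondX F * σ.perm s) =
      superPerm A s * (onSecond (intCoeff F p) * onSecond (intCoeff G q)) -
        onSecond (intCoeff G q) * onSecond (intCoeff F p) * superPerm A s := by
  have h1 := σ.cf_X_mul_Y p q (PowerSeries.map onSecond F) 1 (PowerSeries.map onSecond G)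
  have h2 := σ.cf_Y_mul_X p q (PowerSeries.map onSecond F) 1 (PowerSeries.map onSecond G)
  rw [map_one, mul_one, mul_one, intCoeff_map, intCoeff_map] at h1 h2
  rw [map_sub, Substitution.perm, Substitution.secondX, Substitution.secondY,
    RingHom.comp_apply, RingHom.comp_apply, σ.cf_const_mul, σ.cf_mul_const, h1, h2]

omit [Algebra ℂ A] in
theorem cf_trace (F G : PowerSeries (Matrix (Fin N) (Fin N) A)) (p q : ℤ) :
    σ.cf p q (σ.secondX F * σ.secondY G - σ.secondY G * σ.secondX F) =
      onSecond (intCoeff F p) * onSecond (intCoeff G q) -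
        onSecond (intCoeff G q) * onSecond (intCoeff F p) := by
  have h1 := σ.cf_X_mul_Y p q (PowerSeries.map onSecond F) 1 (PowerSeries.map onSecond G)
  have h2 := σ.cf_Y_mul_X p q (PowerSeries.map onSecond F) 1 (PowerSeries.map onSecond G)
  rw [map_one, mul_one, mul_one, intCoeff_map, intCoeff_map] at h1 h2
  rw [map_sub, Substitution.secondX, Substitution.secondY,
    RingHom.comp_apply, RingHom.comp_apply, h1, h2]

/-- The exchange relations at the arguments `η * x` and `θ * y`, for signs `η` and `θ`: here
`F'` and `G'` are the series `F (η * u)` and `F (θ * u)`, with `e r = η ^ r` and `e' r = θ ^ r`. -/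
theorem IsRTT.exchange {F F' G' : PowerSeries (Matrix (Fin N) (Fin N) A)} {η θ : ℤ}
    {e e' : ℤ → ℤ} (h : IsRTT s F) (he : ∀ r, η * e (r + 1) = e r)
    (he' : ∀ r, θ * e' (r + 1) = e' r)
    (hF : ∀ r, intCoeff F' r = e r • intCoeff F r)
    (hG : ∀ r, intCoeff G' r = e' r • intCoeff F r) :
    (η • σ.x - θ • σ.y - σ.perm s) * (σ.perm s * σ.secondX F' * σ.perm s) * σ.secondY G' =
      σ.secondY G' * (σ.perm s * σ.secondX F' * σ.perm s) *
        (η • σ.x - θ • σ.y - σ.perm s) := by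
  rw [exchange_iff (fun w => ((σ.x_comm w).smul_left η).sub_left ((σ.y_comm w).smul_left θ))
    (perm_mul_self σ)]
  refine σ.ext _ _ fun p q => ?_
  have h1 : ∀ p q, σ.cf p q (σ.perm s * σ.secondX F' * σ.perm s * σ.secondY G' -
        σ.secondY G' * (σ.perm s * σ.secondX F' * σ.perm s)) =
      (e p * e' q) • (superPerm A s * onSecond (intCoeff F p) * superPerm A s *
        onSecond (intCoeff F q) - onSecond (intCoeff F q) *
          (superPerm A s * onSecond (intCoeff F p) * superPerm A s)) := by
    intro p q
    rw [cf_supercomm, hF, hG, map_zsmul, map_zsmul]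
    simp only [smul_mul_assoc, mul_smul_comm, smul_smul, smul_sub, mul_comm (e' q)]
  rw [sub_mul, map_sub, smul_mul_assoc, smul_mul_assoc, map_zsmul, map_zsmul, σ.cf_x_mul,
    σ.cf_y_mul, h1, h1, cf_exchange, hF, hG, map_zsmul, map_zsmul, smul_smul,
    smul_smul, ← mul_assoc, he, mul_left_comm, he', ← smul_sub, (isRTT_iff_coeff F).1 h]
  simp only [smul_mul_assoc, mul_smul_comm, smul_smul, smul_sub, mul_comm (e' q)]

theorem isRTT_iff (F : PowerSeries (Matrix (Fin N) (Fin N) A)) :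
    IsRTT s F ↔
      (σ.x - σ.y - σ.perm s) * (σ.perm s * σ.secondX F * σ.perm s) * σ.secondY F =
        σ.secondY F * (σ.perm s * σ.secondX F * σ.perm s) * (σ.x - σ.y - σ.perm s) := by
  constructor
  · intro h
    have := h.exchange σ (η := 1) (θ := 1) (e := fun _ => 1) (e' := fun _ => 1) (F' := F)
      (G' := F) (by simp) (by simp) (by simp) (by simp)
    simpa only [one_smul] using this
  · intro h
    rw [exchange_iff (fun w => (σ.x_comm w).sub_left (σ.y_comm w)) (perm_mul_self σ)] at h
    rw [isRTT_iff_coeff]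
    intro p q
    have := congrArg (σ.cf p q) h
    rwa [sub_mul, map_sub, σ.cf_x_mul, σ.cf_y_mul, cf_supercomm, cf_supercomm, cf_exchange]
      at this

/-- The reflection equation of operators implies the reflection relations of the entries. -/
theorem isReflection_of_eq (F : PowerSeries (Matrix (Fin N) (Fin N) A))
    (h : (σ.x - σ.y - σ.perm s) * (σ.perm s * σ.secondX F * σ.perm s) *
        (σ.x + σ.y - σ.perm s) * σ.secondY F =
      σ.secondY F * (σ.x + σ.y - σ.perm s) * (σ.perm s * σ.secondX F * σ.perm s) *
        (σ.x - σ.y - σ.perm s)) : IsReflection s F := by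
  rw [reflection_iff σ.x_comm σ.y_comm (perm_mul_self σ)] at h
  intro i j k l p q
  have hK := cf_supercomm (s := s) σ F F
  have hE := cf_exchange (s := s) σ F F
  have hR := cf_reflect (s := s) σ F F
  have hT := cf_trace σ F F
  generalize σ.perm s * σ.secondX F * σ.perm s * σ.secondY F -
      σ.secondY F * (σ.perm s * σ.secondX F * σ.perm s) = K at h hK
  generalize σ.secondX F * σ.perm s * σ.secondY F - σ.secondY F * σ.perm s * σ.secondX F = E
    at h hE
  generalize σ.perm s * (σ.secondX F * σ.secondY F) - σ.secondY F * σ.secondX F * σ.perm s = Q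
    at h hR
  generalize σ.secondX F * σ.secondY F - σ.secondY F * σ.secondX F = Z at h hT
  have h' := congrArg (σ.cf p q) h
  rw [add_mul, sub_mul, map_sub, map_sub, map_add, map_add, map_sub] at h'
  simp only [σ.cf_x_mul, σ.cf_y_mul, hK, hE, hR, hT] at h'
  have h'' := congrFun (congrFun h' (k, i)) (l, j)
  rw [Matrix.sub_apply, supercomm_first_second_apply, supercomm_first_second_apply,
    Matrix.sub_apply, trace_apply, Matrix.add_apply, Matrix.add_apply, exchange_apply,
    exchange_apply, Matrix.sub_apply (superPerm A s * _ - _), reflect_apply, reflect_apply,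
    ← smul_sub, ← smul_add, ← smul_sub, ← smul_add, ← smul_sub] at h''
  have h3 := smul_right_injective A (sgn_ne_zero _) h''
  rw [← smul_add, ← smul_sub] at h3
  have e : ∀ p : ℤ, p + 2 = p + 1 + 1 := fun p => by ring
  rw [reflectionLHS, reflectionRHS, e, e]
  exact h3

/-- If the entries of `F` and `G` supercommute, then `F` on the first and `G` on the second tensor
factor commute. -/
theorem commute_first_second {F G : PowerSeries (Matrix (Fin N) (Fin N) A)}
    (h : ∀ i j k l p q, superComm s i j k l (entries F i j p) (entries G k l q) = 0) :
    Commute (σ.perm s * σ.secondX F * σ.perm s) (σ.secondY G) := by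
  rw [commute_iff_eq, ← sub_eq_zero]
  refine σ.ext _ _ fun p q => ?_
  rw [cf_supercomm, map_zero]
  ext ⟨k, i⟩ ⟨l, j⟩
  rw [supercomm_first_second_apply]
  exact (congrArg _ (h i j k l p q)).trans (smul_zero _)

/-- Two solutions of the exchange relations with supercommuting entries multiply to a solution. -/
theorem IsRTT.mul {F G : PowerSeries (Matrix (Fin N) (Fin N) A)} (hF : IsRTT s F)
    (hG : IsRTT s G)
    (h : ∀ i j k l p q, superComm s i j k l (entries F i j p) (entries G k l q) = 0)
    (h' : ∀ i j k l p q, superComm s i j k l (entries G i j p) (entries F k l q) = 0) :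
    IsRTT s (F * G) := by
  let σ := substUV (Matrix (Fin N × Fin N) (Fin N × Fin N) A)
  rw [isRTT_iff σ] at hF hG ⊢
  rw [map_mul, map_mul]
  exact rtt_mul (perm_mul_self σ) hF hG (commute_first_second σ h) (commute_first_second σ h')

end Substituted

/-! ### The homomorphism from the twisted super Yangian to the super Yangian -/

variable {N : ℕ} {A : Type} [Ring A]

section NegArg

theorem coeff_negArg {R : Type} [Ring R] (f : PowerSeries R) (n : ℕ) :
    PowerSeries.coeff n (negArg f) = (-1) ^ n * PowerSeries.coeff n f := by
  simp [negArg]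

theorem neg_one_pow_mul_comm {R : Type} [Ring R] (n : ℕ) (x : R) :
    x * (-1) ^ n = (-1) ^ n * x := by
  rcases neg_one_pow_eq_or R n with h | h <;> simp [h]

theorem negArg_mul {R : Type} [Ring R] (f g : PowerSeries R) :
    negArg (f * g) = negArg f * negArg g := by
  ext n
  rw [coeff_negArg, PowerSeries.coeff_mul, PowerSeries.coeff_mul, Finset.mul_sum]
  refine Finset.sum_congr rfl fun d hd => ?_
  rw [coeff_negArg, coeff_negArg, ← Finset.HasAntidiagonal.mem_antidiagonal.1 hd, pow_add,
    mul_assoc, mul_assoc, ← mul_assoc (PowerSeries.coeff d.1 f), neg_one_pow_mul_comm, mul_assoc]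

theorem negArg_C {R : Type} [Ring R] (c : R) :
    negArg (PowerSeries.C c) = PowerSeries.C c := by
  ext n
  rw [coeff_negArg, PowerSeries.coeff_C]
  split_ifs with h <;> simp [h]

theorem negArg_one {R : Type} [Ring R] : negArg (1 : PowerSeries R) = 1 :=
  negArg_C 1

theorem negArg_negArg {R : Type} [Ring R] (f : PowerSeries R) : negArg (negArg f) = f := by
  ext n
  rw [coeff_negArg, coeff_negArg, ← mul_assoc, ← pow_add, Even.neg_one_pow ⟨n, rfl⟩, one_mul]

theorem intCoeff_negArg {R : Type} [Ring R] (f : PowerSeries R) (r : ℤ) :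
    intCoeff (negArg f) r = ((r.negOnePow : ℤˣ) : ℤ) • intCoeff f r := by
  rcases lt_or_ge r 0 with h | h
  · simp [intCoeff_of_neg _ h]
  · lift r to ℕ using h
    rw [intCoeff_natCast, intCoeff_natCast, coeff_negArg]
    rcases Nat.even_or_odd r with h | h
    · rw [Int.negOnePow_even _ (by exact_mod_cast h), h.neg_one_pow]; simp
    · rw [Int.negOnePow_odd _ (by exact_mod_cast h), h.neg_one_pow]; simp

end NegArg

section Homs

variable [Algebra ℂ A]

/-- The constant series `diag(ε_1, …, ε_N)`; over the super Yangian this is `G`. -/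
def signSeries (A : Type) [Ring A] (ε : Fin N → ℤˣ) : PowerSeries (Matrix (Fin N) (Fin N) A) :=
  PowerSeries.C (Matrix.diagonal fun i => ((ε i : ℤ) : A))

omit [Algebra ℂ A] in
theorem signSeries_mul_self (ε : Fin N → ℤˣ) : signSeries A ε * signSeries A ε = 1 := by
  rw [signSeries, ← map_mul, Matrix.diagonal_mul_diagonal]
  have : (fun i => ((ε i : ℤ) : A) * ((ε i : ℤ) : A)) = 1 := by
    funext i
    rcases Int.units_eq_one_or (ε i) with h | h <;> simp [h]
  rw [this]
  simp

omit [Algebra ℂ A] in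
theorem entries_C (m : Matrix (Fin N) (Fin N) A) (i j : Fin N) (r : ℤ) :
    entries (PowerSeries.C m) i j r = if r = 0 then m i j else 0 := by
  unfold entries
  rcases lt_or_ge r 0 with h | h
  · rw [intCoeff_of_neg _ h, if_neg h.ne]; rfl
  · lift r to ℕ using h
    rw [intCoeff_natCast, PowerSeries.coeff_C]
    by_cases hr : r = 0 <;> simp [hr]

theorem signSeries_superComm (s ε : Fin N → ℤˣ) (i j k l : Fin N) (p : ℤ) (x : A) :
    superComm s i j k l (entries (signSeries A ε) i j p) x = 0 := by
  rw [signSeries, entries_C, superComm, Matrix.diagonal_apply]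
  split_ifs with h1 h2
  · subst h2
    rw [CharTwo.add_self_eq_zero, zero_mul, sgn_zero, one_smul, (Int.cast_commute _ x).eq,
      sub_self]
  · simp
  · simp

/-- If `F` satisfies the exchange relations, then `F(u) G F⁻¹(-u)` satisfies the reflection
relations. -/
theorem IsRTT.isReflection {s : Fin N → ℤˣ} {F Fi : PowerSeries (Matrix (Fin N) (Fin N) A)}
    (hF : IsRTT s F) (h1 : F * Fi = 1) (h2 : Fi * F = 1) (ε : Fin N → ℤˣ) :
    IsReflection s (F * signSeries A ε * negArg Fi) := by
  let σ := substUV (Matrix (Fin N × Fin N) (Fin N × Fin N) A)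
  let τ := substVU (Matrix (Fin N × Fin N) (Fin N × Fin N) A)
  have hC : σ.secondX (signSeries A ε) = σ.secondY (signSeries A ε) := by
    change HahnSeries.ofPowerSeries _ _ _ = HahnSeries.C (HahnSeries.ofPowerSeries _ _ _)
    simp [signSeries, HahnSeries.ofPowerSeries_C]
  have neg : ∀ r : ℤ, -1 * (((r + 1).negOnePow : ℤˣ) : ℤ) = ((r.negOnePow : ℤˣ) : ℤ) := by
    intro r
    rw [Int.negOnePow_succ]
    simp
  have n1 : negArg F * negArg Fi = 1 := by rw [← negArg_mul, h1, negArg_one]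
  have n2 : negArg Fi * negArg F = 1 := by rw [← negArg_mul, h2, negArg_one]
  apply isReflection_of_eq σ
  rw [map_mul, map_mul, map_mul, map_mul, hC]
  refine reflection_of_rtt (a' := σ.secondX (negArg F)) (b' := σ.secondY (negArg F))
    σ.x_comm σ.y_comm (perm_mul_self σ) ?_ ?_ ?_ ?_ ?_ ?_ ?_ ?_ ?_ ?_ ?_
  · rw [← map_mul, signSeries_mul_self, map_one]
  · rw [← hC]
    have := fun H => commute_first_second (s := s) σ (G := H)
      fun i j k l p q => signSeries_superComm s ε i j k l p (entries H k l q)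
    rintro x (rfl | rfl | rfl)
    · rw [hC]
      simpa only [hC] using this (signSeries A ε)
    · exact this F
    · exact this (negArg Fi)
  · have := fun H => commute_first_second (s := s) τ (G := H)
      fun i j k l p q => signSeries_superComm s ε i j k l p (entries H k l q)
    rintro x (rfl | rfl)
    · exact this F
    · exact this (negArg Fi)
  · rw [← map_mul, n1, map_one]
  · rw [← map_mul, n2, map_one]
  · rw [← map_mul, n1, map_one]
  · rw [← map_mul, n2, map_one]
  -- the exchange relations at `(u, v)`, `(v, -u)`, `(-v, -u)` and `(u, -v)`
  · exact (isRTT_iff σ F).1 hF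
  · have := hF.exchange τ (η := 1) (θ := -1) (e := fun _ => 1) (F' := F) (G' := negArg F)
      (by simp) neg (by simp) (intCoeff_negArg F)
    simp only [one_smul, neg_smul, sub_neg_eq_add] at this
    rw [add_comm σ.x]
    exact this
  · have := hF.exchange τ (η := -1) (θ := -1) (F' := negArg F) (G' := negArg F)
      neg neg (intCoeff_negArg F) (intCoeff_negArg F)
    simp only [one_smul, neg_smul, sub_neg_eq_add, neg_add_eq_sub] at this
    exact this
  · have := hF.exchange σ (η := 1) (θ := -1) (e := fun _ => 1) (F' := F) (G' := negArg F)
      (by simp) neg (by simp) (intCoeff_negArg F)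
    simp only [one_smul, neg_smul, sub_neg_eq_add] at this
    exact this

omit [Algebra ℂ A] in
/-- `F(u) G F⁻¹(-u)` satisfies the unitarity condition, because `G² = 1`. -/
theorem mul_sign_mul_inv_unitary {F Fi : PowerSeries (Matrix (Fin N) (Fin N) A)}
    (h1 : F * Fi = 1) (h2 : Fi * F = 1) (ε : Fin N → ℤˣ) :
    F * signSeries A ε * negArg Fi * negArg (F * signSeries A ε * negArg Fi) = 1 := by
  have n2 : negArg Fi * negArg F = 1 := by rw [← negArg_mul, h2, negArg_one]
  have hs : negArg (signSeries A ε) = signSeries A ε := negArg_C _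
  rw [negArg_mul, negArg_mul, negArg_negArg, hs]
  calc _ = F * signSeries A ε * (negArg Fi * negArg F) * signSeries A ε * Fi := by
        simp only [mul_assoc]
    _ = F * (signSeries A ε * signSeries A ε) * Fi := by rw [n2, mul_one]; simp only [mul_assoc]
    _ = 1 := by rw [signSeries_mul_self, mul_one, h1]

/-- The homomorphism from the free algebra given by the coefficients of a series. -/
def liftGen (F : PowerSeries (Matrix (Fin N) (Fin N) A)) : FreeAlgebra ℂ (Gen N) →ₐ[ℂ] A :=
  FreeAlgebra.lift ℂ fun g => PowerSeries.coeff g.2.2 F g.1 g.2.1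

theorem liftGen_freeCoeff {F : PowerSeries (Matrix (Fin N) (Fin N) A)} {c : Fin N → Fin N → ℂ}
    (hF : ∀ i j, PowerSeries.coeff 0 F i j = algebraMap ℂ A (c i j)) (i j : Fin N) (r : ℤ) :
    liftGen F (freeCoeff c i j r) = entries F i j r := by
  unfold freeCoeff entries intCoeff liftGen
  split_ifs with h1 h2 h3 h4
  · rw [FreeAlgebra.lift_ι_apply]
    rfl
  · omega
  · subst h3
    rw [AlgHom.commutes, ← hF]
    rfl
  · omega
  · omega
  · simp

variable {A' : Type} [Ring A'] [Algebra ℂ A'] (f : A' →ₐ[ℂ] A) (s : Fin N → ℤˣ)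
  (x : Fin N → Fin N → ℤ → A') (i j k l : Fin N) (p q : ℤ)

theorem map_rttLHS : f (rttLHS s x i j k l p q) =
    rttLHS s (fun i j r => f (x i j r)) i j k l p q := by
  simp [rttLHS, commCoeff, superComm]

theorem map_rttRHS : f (rttRHS s x i j k l p q) =
    rttRHS s (fun i j r => f (x i j r)) i j k l p q := by
  simp [rttRHS, exchangeCoeff]

theorem map_reflectionLHS : f (reflectionLHS s x i j k l p q) =
    reflectionLHS s (fun i j r => f (x i j r)) i j k l p q := by
  simp [reflectionLHS, commCoeff, superComm]

theorem map_reflectionRHS : f (reflectionRHS s x i j k l p q) =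
    reflectionRHS s (fun i j r => f (x i j r)) i j k l p q := by
  simp [reflectionRHS, exchangeCoeff, reflectCoeff, traceCoeff, apply_ite f]

theorem map_unitaryLHS (n : ℕ) : f (unitaryLHS x i j n) =
    unitaryLHS (fun i j r => f (x i j r)) i j n := by
  simp [unitaryLHS]

theorem unitaryLHS_entries (F : PowerSeries (Matrix (Fin N) (Fin N) A)) (n : ℕ) :
    unitaryLHS (entries F) i j n = PowerSeries.coeff n (F * negArg F) i j := by
  rw [PowerSeries.coeff_mul, Matrix.sum_apply, unitaryLHS, Finset.sum_comm]
  refine Finset.sum_congr rfl fun d _ => ?_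
  rw [Matrix.mul_apply]
  refine Finset.sum_congr rfl fun a _ => ?_
  rw [coeff_negArg, entries, entries, intCoeff_natCast, intCoeff_natCast]
  rcases neg_one_pow_eq_or ℂ d.2 with h | h <;>
  rcases Nat.even_or_odd d.2 with h' | h' <;> simp [h'.neg_one_pow]

/-- The homomorphism from the super Yangian which maps `T(u)` to a given solution of the exchange
relations. -/
def yangianLift (F : PowerSeries (Matrix (Fin N) (Fin N) A)) (hF : IsRTT s F)
    (h0 : PowerSeries.coeff 0 F = 1) : Yangian s →ₐ[ℂ] A :=
  RingQuot.liftAlgHom ℂ ⟨liftGen F, by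
    rintro _ _ ⟨i, j, k, l, p, q⟩
    have h : ∀ i j r, liftGen F (freeCoeff yConst i j r) = entries F i j r :=
      liftGen_freeCoeff fun i j => by rw [h0, Matrix.one_apply, yConst]; split_ifs <;> simp
    rw [map_rttLHS, map_rttRHS]
    simp only [h]
    exact hF i j k l p q⟩

theorem yangianLift_tCoeff {F : PowerSeries (Matrix (Fin N) (Fin N) A)} (hF : IsRTT s F)
    (h0 : PowerSeries.coeff 0 F = 1) (i j : Fin N) (r : ℕ) :
    yangianLift s F hF h0 (tCoeff s i j r) = PowerSeries.coeff r F i j := by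
  rw [yangianLift, tCoeff, RingQuot.liftAlgHom_mkAlgHom_apply,
    liftGen_freeCoeff (fun i j => by rw [h0, Matrix.one_apply, yConst]; split_ifs <;> simp),
    entries, intCoeff_natCast]

theorem bConst_eq (ε : Fin N → ℤˣ) (i j : Fin N) : algebraMap ℂ A (bConst ε i j) =
    Matrix.diagonal (fun i => ((ε i : ℤ) : A)) i j := by
  rw [bConst, Matrix.diagonal_apply]
  split_ifs <;> simp

/-- The homomorphism from the twisted super Yangian which maps `B(u)` to a given unitary solution of
the reflection relations. -/
def twistedLift (ε : Fin N → ℤˣ) (F : PowerSeries (Matrix (Fin N) (Fin N) A))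
    (hF : IsReflection s F) (hF' : F * negArg F = 1)
    (h0 : PowerSeries.coeff 0 F = Matrix.diagonal fun i => ((ε i : ℤ) : A)) :
    TwistedYangian s ε →ₐ[ℂ] A :=
  RingQuot.liftAlgHom ℂ ⟨liftGen F, by
    have h : ∀ i j r, liftGen F (freeCoeff (bConst ε) i j r) = entries F i j r :=
      liftGen_freeCoeff fun i j => by rw [h0, bConst_eq]
    rintro _ _ (⟨i, j, k, l, p, q⟩ | ⟨i, j, n⟩)
    · rw [map_reflectionLHS, map_reflectionRHS]
      simp only [h]
      exact hF i j k l p q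
    · rw [map_unitaryLHS]
      simp only [h]
      rw [unitaryLHS_entries, hF', PowerSeries.coeff_one]
      split_ifs with h1 h2 h2
      · rw [h2.2, Matrix.one_apply_eq, map_one]
      · rw [Matrix.one_apply_ne fun h => h2 ⟨h1, h⟩, map_zero]
      · exact absurd h2.1 h1
      · simp⟩

theorem twistedLift_bCoeff {ε : Fin N → ℤˣ} {F : PowerSeries (Matrix (Fin N) (Fin N) A)}
    (hF : IsReflection s F) (hF' : F * negArg F = 1)
    (h0 : PowerSeries.coeff 0 F = Matrix.diagonal fun i => ((ε i : ℤ) : A))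
    (i j : Fin N) (r : ℕ) :
    twistedLift s ε F hF hF' h0 (bCoeff s ε i j r) = PowerSeries.coeff r F i j := by
  rw [twistedLift, bCoeff, RingQuot.liftAlgHom_mkAlgHom_apply,
    liftGen_freeCoeff (fun i j => by rw [h0, bConst_eq]), entries, intCoeff_natCast]

end Homs

section Phi

variable (s ε : Fin N → ℤˣ)

theorem freeCoeff_of_neg (c : Fin N → Fin N → ℂ) (i j : Fin N) {r : ℤ} (h : r < 0) :
    freeCoeff c i j r = 0 := by
  rw [freeCoeff, dif_neg (by omega), if_neg (by omega)]

theorem entries_T (i j : Fin N) (r : ℤ) :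
    entries (T s) i j r = RingQuot.mkAlgHom ℂ (YangianRel s) (freeCoeff yConst i j r) := by
  unfold entries
  rcases lt_or_ge r 0 with h | h
  · rw [intCoeff_of_neg _ h, freeCoeff_of_neg _ _ _ h, map_zero]
    rfl
  · lift r to ℕ using h
    rw [intCoeff_natCast, T, PowerSeries.coeff_mk]
    rfl

theorem isRTT_T : IsRTT s (T s) := by
  intro i j k l p q
  have h := RingQuot.mkAlgHom_rel ℂ (YangianRel.rtt (s := s) i j k l p q)
  rw [map_rttLHS, map_rttRHS] at h
  simp only [← entries_T] at h
  exact h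

/-- The matrix `T(u) G T⁻¹(-u)`. -/
def TGT : PowerSeries (Matrix (Fin N) (Fin N) (Yangian s)) :=
  T s * G s ε * negArg (TInv s)

theorem coeff_zero_TInv : PowerSeries.coeff 0 (TInv s) = 1 := by
  have h := congrArg PowerSeries.constantCoeff (T_mul_TInv s)
  rw [map_mul, constantCoeff_T, one_mul, map_one] at h
  simpa using h

theorem coeff_zero_TGT :
    PowerSeries.coeff 0 (TGT s ε) = Matrix.diagonal fun i => ((ε i : ℤ) : Yangian s) := by
  have h : PowerSeries.constantCoeff (negArg (TInv s)) = 1 := by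
    rw [← PowerSeries.coeff_zero_eq_constantCoeff_apply, coeff_negArg, coeff_zero_TInv]
    simp
  rw [TGT, PowerSeries.coeff_zero_eq_constantCoeff_apply, map_mul, map_mul, h, constantCoeff_T, G]
  simp

/-- The homomorphism `B(u) ↦ T(u) G T⁻¹(-u)`, as a homomorphism of associative algebras. -/
def phi : TwistedYangian s ε →ₐ[ℂ] Yangian s :=
  twistedLift s ε (TGT s ε) ((isRTT_T s).isReflection (T_mul_TInv s) (TInv_mul_T s) ε)
    (mul_sign_mul_inv_unitary (T_mul_TInv s) (TInv_mul_T s) ε) (coeff_zero_TGT s ε)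

theorem phi_bCoeff (i j : Fin N) (r : ℕ) :
    phi s ε (bCoeff s ε i j r) = PowerSeries.coeff r (TGT s ε) i j :=
  twistedLift_bCoeff s _ _ _ i j r

theorem mapSeries_phi : mapSeries (phi s ε) (B s ε) = T s * G s ε * negArg (TInv s) := by
  ext r i j
  simp only [mapSeries, B, PowerSeries.coeff_mk, Matrix.map_apply, Matrix.of_apply]
  exact phi_bCoeff s ε i j r

/-- The `(i, j)` entries of all coefficients of `F` have parity `|i| + |j|`. -/
def IsHomogeneous (F : PowerSeries (Matrix (Fin N) (Fin N) (Yangian s))) : Prop :=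
  ∀ r i j, PowerSeries.coeff r F i j ∈ yangianParity s (parity s i + parity s j)

variable {s}

theorem isHomogeneous_T : IsHomogeneous s (T s) := by
  intro r i j
  rw [T, PowerSeries.coeff_mk]
  exact quotParity_mk _ _ (freeCoeff_mem s yConst_diag i j r)

theorem homogeneous_matrix_mul {x y : Matrix (Fin N) (Fin N) (Yangian s)}
    (hx : ∀ i j, x i j ∈ yangianParity s (parity s i + parity s j))
    (hy : ∀ i j, y i j ∈ yangianParity s (parity s i + parity s j)) (i j : Fin N) :
    (x * y) i j ∈ yangianParity s (parity s i + parity s j) := by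
  rw [Matrix.mul_apply]
  refine Submodule.sum_mem _ fun a _ => ?_
  have h := SetLike.mul_mem_graded (hx i a) (hy a j)
  have e : ∀ a b c : ZMod 2, a + b + (b + c) = a + c := by decide
  rwa [e] at h

theorem IsHomogeneous.mul {F F' : PowerSeries (Matrix (Fin N) (Fin N) (Yangian s))}
    (hF : IsHomogeneous s F) (hF' : IsHomogeneous s F') : IsHomogeneous s (F * F') := by
  intro r i j
  rw [PowerSeries.coeff_mul, Matrix.sum_apply]
  exact Submodule.sum_mem _ fun d _ => homogeneous_matrix_mul (hF d.1) (hF' d.2) i j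

theorem isHomogeneous_C_diagonal (d : Fin N → ℤ) :
    IsHomogeneous s (PowerSeries.C (Matrix.diagonal fun i => (d i : Yangian s))) := by
  intro r i j
  rw [PowerSeries.coeff_C]
  split_ifs
  · rw [Matrix.diagonal_apply]
    split_ifs with h
    · rw [h, CharTwo.add_self_eq_zero]
      exact SetLike.intCast_mem_graded _ _
    · exact zero_mem _
  · exact zero_mem _

theorem IsHomogeneous.negArg {F : PowerSeries (Matrix (Fin N) (Fin N) (Yangian s))}
    (hF : IsHomogeneous s F) : IsHomogeneous s (negArg F) := by
  intro r i j
  rw [coeff_negArg]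
  rcases neg_one_pow_eq_or (Matrix (Fin N) (Fin N) (Yangian s)) r with h | h
  · rw [h, one_mul]
    exact hF r i j
  · rw [h, neg_one_mul]
    exact neg_mem (hF r i j)

theorem coeff_TInv (r : ℕ) : PowerSeries.coeff (r + 1) (TInv s) =
    -∑ d ∈ Finset.HasAntidiagonal.antidiagonal r,
      PowerSeries.coeff (d.1 + 1) (T s) * PowerSeries.coeff d.2 (TInv s) := by
  have h := congrArg (PowerSeries.coeff (r + 1)) (T_mul_TInv s)
  rw [PowerSeries.coeff_mul, Finset.Nat.sum_antidiagonal_succ, PowerSeries.coeff_one,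
    if_neg (Nat.succ_ne_zero r), PowerSeries.coeff_zero_eq_constantCoeff_apply, constantCoeff_T,
    one_mul] at h
  exact eq_neg_of_add_eq_zero_left h

theorem isHomogeneous_TInv : IsHomogeneous s (TInv s) := by
  intro r
  induction r using Nat.strong_induction_on with
  | _ r ih =>
    cases r with
    | zero =>
      rw [coeff_zero_TInv]
      have := isHomogeneous_C_diagonal (s := s) (fun _ => 1) 0
      simpa using this
    | succ r =>
      intro i j
      rw [coeff_TInv, Matrix.neg_apply, Matrix.sum_apply]
      refine neg_mem (Submodule.sum_mem _ fun d hd =>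
        homogeneous_matrix_mul (isHomogeneous_T _) (ih _ ?_) i j)
      have := Finset.HasAntidiagonal.mem_antidiagonal.1 hd
      omega

theorem isHomogeneous_TGT : IsHomogeneous s (TGT s ε) :=
  (isHomogeneous_T.mul (isHomogeneous_C_diagonal _)).mul isHomogeneous_TInv.negArg

theorem map_freeParity_mem {f : FreeAlgebra ℂ (Gen N) →ₐ[ℂ] Yangian s}
    (hf : ∀ g, f (FreeAlgebra.ι ℂ g) ∈ yangianParity s (genParity s g)) {d : ZMod 2}
    {w : FreeAlgebra ℂ (Gen N)} (hw : w ∈ freeParity (genParity s) d) :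
    f w ∈ yangianParity s d := by
  have h : freeParity (genParity s) d ≤ (yangianParity s d).comap f.toLinearMap := by
    refine Submodule.span_le.2 ?_
    rintro _ ⟨l, rfl, rfl⟩
    change f _ ∈ yangianParity s _
    clear hw
    induction l with
    | nil => simpa using SetLike.one_mem_graded (yangianParity s)
    | cons g l ih =>
      rw [List.map_cons, List.map_cons, List.prod_cons, map_mul, List.sum_cons]
      exact SetLike.mul_mem_graded (hf g) ih
  exact h hw

theorem freeCoeff_gen (c : Fin N → Fin N → ℂ) (g : Gen N) :
    freeCoeff c g.1 g.2.1 (g.2.2 : ℕ) = FreeAlgebra.ι ℂ g := by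
  rw [freeCoeff, dif_pos (by exact_mod_cast g.2.2.2)]
  rfl

variable (s)

/-- `phi` as a homomorphism of superalgebras. -/
def gradedPhi : twistedParity s ε →ₐᵍ[ℂ] yangianParity s :=
  { phi s ε with
    map_mem := by
      rintro d _ ⟨w, hw, rfl⟩
      refine map_freeParity_mem (f := (phi s ε).comp (RingQuot.mkAlgHom ℂ _)) (fun g => ?_) hw
      have h := isHomogeneous_TGT (s := s) ε g.2.2 g.1 g.2.1
      rw [← phi_bCoeff, bCoeff, freeCoeff_gen] at h
      exact h }

end Phi

/-! ### The ordered monomials span -/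

section Spanning

variable {N : ℕ} {s ε : Fin N → ℤˣ}

variable (s ε) in
/-- The coefficient of `u ^ (-r)` in `b_{ij}(u)`, for an integer `r`. -/
def bInt (i j : Fin N) (r : ℤ) : TwistedYangian s ε :=
  RingQuot.mkAlgHom ℂ (TwistedRel s ε) (freeCoeff (bConst ε) i j r)

theorem bInt_natCast (i j : Fin N) (r : ℕ) : bInt s ε i j r = bCoeff s ε i j r := rfl

theorem bInt_of_neg (i j : Fin N) {r : ℤ} (h : r < 0) : bInt s ε i j r = 0 := by
  rw [bInt, freeCoeff_of_neg _ _ _ h, map_zero]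

theorem bInt_zero (i j : Fin N) : bInt s ε i j 0 = algebraMap ℂ _ (bConst ε i j) := by
  simp [bInt, freeCoeff]

theorem bInt_reflection (i j k l : Fin N) (p q : ℤ) :
    reflectionLHS s (bInt s ε) i j k l p q = reflectionRHS s (bInt s ε) i j k l p q := by
  have h := RingQuot.mkAlgHom_rel ℂ (TwistedRel.reflection (s := s) (ε := ε) i j k l p q)
  rw [map_reflectionLHS, map_reflectionRHS] at h
  exact h

theorem bInt_unitary (i j : Fin N) {n : ℕ} (hn : n ≠ 0) : unitaryLHS (bInt s ε) i j n = 0 := by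
  have h := RingQuot.mkAlgHom_rel ℂ (TwistedRel.unitary (s := s) (ε := ε) i j n)
  rw [map_unitaryLHS, if_neg (by tauto), map_zero] at h
  exact h

variable (s ε) in
/-- The product of the letters of a word in the generators of the basis theorem. -/
def word (l : List (PBWGen ε)) : TwistedYangian s ε :=
  (l.map fun g => bCoeff s ε g.i g.j g.r).prod

/-- The sum of the upper indices of the letters of a word. -/
def weight (l : List (PBWGen ε)) : ℤ := (l.map fun g => ((g.r : ℕ) : ℤ)).sum

variable (s ε) in
/-- The span of the words of weight at most `n`. -/
def weightFilt (n : ℤ) : Submodule ℂ (TwistedYangian s ε) :=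
  Submodule.span ℂ {w | ∃ l, weight l ≤ n ∧ word s ε l = w}

theorem weight_cons (g : PBWGen ε) (l : List (PBWGen ε)) :
    weight (g :: l) = ((g.r : ℕ) : ℤ) + weight l := by simp [weight]

theorem weight_append (l l' : List (PBWGen ε)) : weight (l ++ l') = weight l + weight l' := by
  simp [weight]

theorem weight_nonneg (l : List (PBWGen ε)) : 0 ≤ weight l :=
  List.sum_nonneg (by simp only [List.mem_map]; rintro _ ⟨g, _, rfl⟩; positivity)

theorem weight_perm {l l' : List (PBWGen ε)} (h : l.Perm l') : weight l = weight l' :=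
  (h.map _).sum_eq

theorem word_cons (g : PBWGen ε) (l : List (PBWGen ε)) :
    word s ε (g :: l) = bCoeff s ε g.i g.j g.r * word s ε l := by simp [word]

theorem word_mem (l : List (PBWGen ε)) : word s ε l ∈ weightFilt s ε (weight l) :=
  Submodule.subset_span ⟨l, le_rfl, rfl⟩

theorem weightFilt_mono {m n : ℤ} (h : m ≤ n) : weightFilt s ε m ≤ weightFilt s ε n :=
  Submodule.span_mono fun _ ⟨l, hl, e⟩ => ⟨l, hl.trans h, e⟩

theorem mul_mem_weightFilt {m n : ℤ} {x y : TwistedYangian s ε} (hx : x ∈ weightFilt s ε m)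
    (hy : y ∈ weightFilt s ε n) : x * y ∈ weightFilt s ε (m + n) := by
  have h : weightFilt s ε m * weightFilt s ε n ≤ weightFilt s ε (m + n) := by
    unfold weightFilt
    rw [Submodule.span_mul_span, Submodule.span_le]
    rintro _ ⟨_, ⟨l, hl, rfl⟩, _, ⟨l', hl', rfl⟩, rfl⟩
    exact Submodule.subset_span ⟨l ++ l', by rw [weight_append]; omega, by simp [word]⟩
  exact h (Submodule.mul_mem_mul hx hy)

theorem algebraMap_mem_weightFilt (c : ℂ) :
    algebraMap ℂ (TwistedYangian s ε) c ∈ weightFilt s ε 0 := by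
  rw [Algebra.algebraMap_eq_smul_one]
  exact Submodule.smul_mem _ _ (word_mem [])

theorem gen_mem_weightFilt (g : PBWGen ε) :
    bCoeff s ε g.i g.j g.r ∈ weightFilt s ε (g.r : ℕ) := by
  have := word_mem (s := s) [g]
  simpa [word, weight] using this

/-- All generators lie in the filtration: unitarity expresses a generator which is not one of the
basis theorem through products of generators with smaller upper indices. -/
theorem bInt_mem_weightFilt (i j : Fin N) (r : ℤ) : bInt s ε i j r ∈ weightFilt s ε r := by
  rcases lt_or_ge r 0 with h | h
  · rw [bInt_of_neg _ _ h]
    exact zero_mem _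
  lift r to ℕ using h
  induction r using Nat.strong_induction_on generalizing i j with
  | _ r ih =>
    rcases Nat.eq_zero_or_pos r with rfl | hr
    · rw [Nat.cast_zero, bInt_zero]
      exact algebraMap_mem_weightFilt _
    by_cases hg : (ε i = ε j ∧ Odd r) ∨ (ε i ≠ ε j ∧ Even r)
    · exact gen_mem_weightFilt ⟨i, j, ⟨r, hr⟩, hg⟩
    have hu := bInt_unitary (s := s) (ε := ε) i j hr.ne'
    rw [unitaryLHS, Finset.sum_comm] at hu
    have m1 : (r, 0) ∈ Finset.HasAntidiagonal.antidiagonal r := by simp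
    have m2 : (0, r) ∈ (Finset.HasAntidiagonal.antidiagonal r).erase (r, 0) := by
      simp [hr.ne']
    rw [← Finset.add_sum_erase _ _ m1, ← Finset.add_sum_erase _ _ m2, ← add_assoc] at hu
    -- the two terms which contain `b_{ij}^{(r)}`, with coefficients `ε_j` and `(-1) ^ r ε_i`
    have t1 : ∑ a, (-1 : ℂ) ^ 0 • (bInt s ε i a r * bInt s ε a j (0 : ℕ)) =
        ((ε j : ℤ) : ℂ) • bInt s ε i j r := by
      rw [Finset.sum_eq_single j]
      · rw [Nat.cast_zero, bInt_zero, bConst, if_pos rfl, pow_zero, one_smul,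
          ← Algebra.commutes, Algebra.smul_def]
      · intro a _ ha
        rw [Nat.cast_zero, bInt_zero, bConst, if_neg ha, map_zero, mul_zero, smul_zero]
      · simp
    have t2 : ∑ a, (-1 : ℂ) ^ r • (bInt s ε i a (0 : ℕ) * bInt s ε a j r) =
        ((-1 : ℂ) ^ r * ((ε i : ℤ) : ℂ)) • bInt s ε i j r := by
      rw [Finset.sum_eq_single i]
      · rw [Nat.cast_zero, bInt_zero, bConst, if_pos rfl, mul_smul, Algebra.smul_def (_ : ℂ)
          (bInt s ε i j r)]
      · intro a _ ha
        rw [Nat.cast_zero, bInt_zero, bConst, if_neg ha.symm, map_zero, zero_mul, smul_zero]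
      · simp
    rw [t1, t2, ← add_smul] at hu
    have hc : ((ε j : ℤ) : ℂ) + (-1 : ℂ) ^ r * ((ε i : ℤ) : ℂ) ≠ 0 := by
      rcases Nat.even_or_odd r with he | ho
      · have : ε i = ε j := by by_contra h; exact hg (.inr ⟨h, he⟩)
        rw [he.neg_one_pow, this]
        rcases Int.units_eq_one_or (ε j) with h | h <;> rw [h] <;> norm_num
      · have : ε i ≠ ε j := fun h => hg (.inl ⟨h, ho⟩)
        rw [ho.neg_one_pow]
        rcases Int.units_eq_one_or (ε j) with h | h <;>
          rcases Int.units_eq_one_or (ε i) with h' | h' <;> rw [h, h'] at this ⊢ <;>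
            first | exact absurd rfl this | norm_num
    rw [← Submodule.smul_mem_iff _ hc, eq_neg_of_add_eq_zero_left hu]
    refine neg_mem (Submodule.sum_mem _ fun d hd => Submodule.sum_mem _ fun a _ =>
      Submodule.smul_mem _ _ ?_)
    simp only [Finset.mem_erase, Finset.HasAntidiagonal.mem_antidiagonal, ne_eq] at hd
    obtain ⟨h1, h2, h3⟩ := hd
    have h4 : d.1 ≠ 0 := fun h => h1 (Prod.ext h (by simp; omega))
    have h5 : d.2 ≠ 0 := fun h => h2 (Prod.ext (by simp; omega) h)
    have := mul_mem_weightFilt (ih d.1 (by omega) i a) (ih d.2 (by omega) a j)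
    rwa [← Nat.cast_add, h3] at this

theorem bInt_mul_mem (i j k l : Fin N) {p q n : ℤ} (h : p + q ≤ n) :
    bInt s ε i j p * bInt s ε k l q ∈ weightFilt s ε n :=
  weightFilt_mono h (mul_mem_weightFilt (bInt_mem_weightFilt i j p) (bInt_mem_weightFilt k l q))

theorem reflectionRHS_mem (i j k l : Fin N) (p q : ℤ) :
    reflectionRHS s (bInt s ε) i j k l p q ∈ weightFilt s ε (p + q + 1) := by
  have he : ∀ p q n : ℤ, p + q ≤ n →
      exchangeCoeff (bInt s ε) i j k l p q ∈ weightFilt s ε n := fun p q n h =>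
    sub_mem (bInt_mul_mem _ _ _ _ h) (bInt_mul_mem _ _ _ _ (by omega))
  have hr : ∀ p q n : ℤ, p + q ≤ n →
      reflectCoeff (bInt s ε) i j k l p q ∈ weightFilt s ε n := fun p q n h => by
    refine sub_mem ?_ ?_ <;> split_ifs
    · exact Submodule.sum_mem _ fun a _ => bInt_mul_mem _ _ _ _ h
    · exact zero_mem _
    · exact Submodule.sum_mem _ fun a _ => bInt_mul_mem _ _ _ _ (by omega)
    · exact zero_mem _
  refine sub_mem (add_mem (Submodule.smul_mem _ _ (add_mem (he _ _ _ ?_) (he _ _ _ ?_)))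
    (Submodule.smul_mem _ _ (sub_mem (hr _ _ _ ?_) (hr _ _ _ ?_)))) ?_
  any_goals omega
  unfold traceCoeff
  split_ifs
  · exact sub_mem (Submodule.sum_mem _ fun a _ => bInt_mul_mem _ _ _ _ (by omega))
      (Submodule.sum_mem _ fun a _ => bInt_mul_mem _ _ _ _ (by omega))
  · exact zero_mem _

theorem commCoeff_nonpos (i j k l : Fin N) {p : ℤ} (q : ℤ) (hp : p ≤ 0) :
    commCoeff s (bInt s ε) i j k l p q = 0 := by
  unfold commCoeff superComm
  rcases hp.lt_or_eq with h | rfl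
  · simp [bInt_of_neg _ _ h]
  · rw [bInt_zero, bConst]
    split_ifs with h
    · rw [h, CharTwo.add_self_eq_zero, zero_mul, sgn_zero, one_smul, Algebra.commutes, sub_self]
    · simp

/-- The associated graded algebra is supercommutative. The reflection relation reduces the
supercommutator for `(p, q)` to that for `(p - 2, q + 2)`, up to terms of smaller weight, and it
vanishes for `p ≤ 0`. -/
theorem commCoeff_mem_weightFilt (i j k l : Fin N) (p q : ℤ) :
    commCoeff s (bInt s ε) i j k l p q ∈ weightFilt s ε (p + q - 1) := by
  obtain ⟨n, hn⟩ : ∃ n : ℕ, p ≤ n := ⟨p.toNat, by omega⟩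
  induction n using Nat.strong_induction_on generalizing p q with
  | _ n ih =>
    rcases le_or_gt p 0 with h | h
    · rw [commCoeff_nonpos _ _ _ _ _ h]
      exact zero_mem _
    · have hr := bInt_reflection (s := s) (ε := ε) i j k l (p - 2) q
      rw [reflectionLHS, sub_add_cancel, sub_eq_iff_eq_add] at hr
      rw [hr]
      have h1 := reflectionRHS_mem (s := s) (ε := ε) i j k l (p - 2) q
      have h2 := ih (n - 1) (by omega) (p - 2) (q + 2) (by omega)
      rw [show p - 2 + q + 1 = p + q - 1 by ring] at h1
      rw [show p - 2 + (q + 2) - 1 = p + q - 1 by ring] at h2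
      exact add_mem h1 h2

/-- Up to terms of smaller weight and a sign, a word does not depend on the order of its letters. -/
theorem word_perm {l l' : List (PBWGen ε)} (h : l.Perm l') :
    ∃ c : ℂ, word s ε l - c • word s ε l' ∈ weightFilt s ε (weight l - 1) := by
  induction h with
  | nil => exact ⟨1, by simp⟩
  | @cons g l l' _ ih =>
    obtain ⟨c, hc⟩ := ih
    refine ⟨c, ?_⟩
    rw [word_cons, word_cons, ← mul_smul_comm, ← mul_sub, weight_cons, add_sub_assoc]
    exact mul_mem_weightFilt (gen_mem_weightFilt g) hc
  | swap g h l =>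
    refine ⟨sgn ((parity s h.i + parity s h.j) * (parity s g.i + parity s g.j)), ?_⟩
    have := mul_mem_weightFilt
      (commCoeff_mem_weightFilt (s := s) (ε := ε) h.i h.j g.i g.j (h.r : ℕ) (g.r : ℕ)) (word_mem l)
    rw [commCoeff, superComm, bInt_natCast, bInt_natCast, sub_mul, smul_mul_assoc, mul_assoc,
      mul_assoc] at this
    rw [word_cons, word_cons, word_cons, word_cons, weight_cons, weight_cons]
    convert this using 2
    ring
  | @trans l₁ l₂ l₃ h₁ _ ih₁ ih₂ =>
    obtain ⟨c, hc⟩ := ih₁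
    obtain ⟨d, hd⟩ := ih₂
    refine ⟨c * d, ?_⟩
    rw [← weight_perm h₁] at hd
    have := add_mem hc (Submodule.smul_mem _ c hd)
    rwa [smul_sub, smul_smul, sub_add_sub_cancel] at this

theorem superComm_self_of_odd {A : Type} [Ring A] [Algebra ℂ A] {i j : Fin N}
    (h : parity s i + parity s j = 1) (x : A) : superComm s i j i j x x = (2 : ℂ) • (x * x) := by
  rw [superComm, h, mul_one, show sgn 1 = -1 by simp [sgn, ZMod.val_one], neg_smul, one_smul,
    sub_neg_eq_add, two_smul]

/-- The square of an odd generator has smaller weight, since it is half of a supercommutator. -/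
theorem odd_mul_self_mem {g : PBWGen ε} (hg : genParity s (g.i, g.j, g.r) = 1) :
    bCoeff s ε g.i g.j g.r * bCoeff s ε g.i g.j g.r ∈
      weightFilt s ε (((g.r : ℕ) : ℤ) + (g.r : ℕ) - 1) := by
  have h := commCoeff_mem_weightFilt (s := s) (ε := ε) g.i g.j g.i g.j (g.r : ℕ) (g.r : ℕ)
  rw [commCoeff, superComm_self_of_odd hg] at h
  exact (Submodule.smul_mem_iff _ two_ne_zero).1 h

/-- The increasing word whose product is the ordered monomial with exponents `f`. -/
def sortedList [LinearOrder (PBWGen ε)] (f : PBWGen ε →₀ ℕ) : List (PBWGen ε) :=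
  (f.support.sort (· ≤ ·)).flatMap fun g => List.replicate (f g) g

theorem word_sortedList [LinearOrder (PBWGen ε)] (f : PBWGen ε →₀ ℕ) :
    word s ε (sortedList f) = orderedMonomial s ε f := by
  rw [word, sortedList, orderedMonomial, List.map_flatMap]
  generalize f.support.sort (· ≤ ·) = L
  induction L with
  | nil => rfl
  | cons g L ih => simp [← ih]

theorem coe_sortedList [LinearOrder (PBWGen ε)] (f : PBWGen ε →₀ ℕ) :
    (sortedList f : Multiset (PBWGen ε)) = Finsupp.toMultiset f := by
  have h : ∀ L : List (PBWGen ε), ((L.flatMap fun g => List.replicate (f g) g :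
      List (PBWGen ε)) : Multiset (PBWGen ε)) = (L.map fun g => f g • ({g} : Multiset _)).sum := by
    intro L
    induction L with
    | nil => rfl
    | cons g L ih =>
      rw [List.flatMap_cons, ← Multiset.coe_add, ih, List.map_cons, List.sum_cons,
        Multiset.nsmul_singleton, Multiset.coe_replicate]
  rw [sortedList, h, Finsupp.toMultiset_apply, Finsupp.sum, Finset.sum_eq_multiset_sum,
    ← Finset.sort_eq f.support (· ≤ ·), Multiset.map_coe, Multiset.sum_coe]

/-- Sorting the letters of a word, and dropping the words with a repeated odd letter, only costs
terms of smaller weight. -/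
theorem weightFilt_le_span [LinearOrder (PBWGen ε)] (n : ℕ) :
    weightFilt s ε ((n : ℤ) - 1) ≤
      Submodule.span ℂ (Set.range fun f : PBWExponent s ε => orderedMonomial s ε f.1) := by
  classical
  induction n with
  | zero =>
    refine Submodule.span_le.2 ?_
    rintro _ ⟨l, hl, rfl⟩
    have := weight_nonneg l
    omega
  | succ n ih =>
    refine Submodule.span_le.2 ?_
    rintro _ ⟨l, hl, rfl⟩
    have low : weightFilt s ε (weight l - 1) ≤
        Submodule.span ℂ (Set.range fun f : PBWExponent s ε => orderedMonomial s ε f.1) :=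
      (weightFilt_mono (by push_cast at hl; omega)).trans ih
    by_cases hf : ∀ g : PBWGen ε, genParity s (g.i, g.j, g.r) = 1 → l.count g ≤ 1
    · have hp : l.Perm (sortedList (Multiset.toFinsupp (l : Multiset (PBWGen ε)))) := by
        rw [← Multiset.coe_eq_coe, coe_sortedList, Multiset.toFinsupp_toMultiset]
      obtain ⟨c, hc⟩ := word_perm (s := s) hp
      rw [SetLike.mem_coe, ← sub_add_cancel (word s ε l) (c • word s ε _)]
      refine add_mem (low hc) (Submodule.smul_mem _ _ (Submodule.subset_span
        ⟨⟨Multiset.toFinsupp (l : Multiset (PBWGen ε)), fun g hg => ?_⟩,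
          (word_sortedList _).symm⟩))
      simpa using hf g hg
    · push Not at hf
      obtain ⟨g, hg, hc⟩ := hf
      obtain ⟨l', hl'⟩ : ∃ l', l.Perm (g :: g :: l') := by
        have h1 : g ∈ l := List.count_pos_iff.1 (by omega)
        have h2 : g ∈ l.erase g := by
          rw [← List.count_pos_iff, List.count_erase_self]
          omega
        exact ⟨_, (List.perm_cons_erase h1).trans ((List.perm_cons_erase h2).cons g)⟩
      obtain ⟨c, hc⟩ := word_perm (s := s) hl'
      rw [SetLike.mem_coe, ← sub_add_cancel (word s ε l) (c • word s ε _)]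
      refine low (add_mem hc (Submodule.smul_mem _ _ ?_))
      rw [word_cons, word_cons, ← mul_assoc, weight_perm hl', weight_cons, weight_cons]
      have := mul_mem_weightFilt (odd_mul_self_mem hg) (word_mem (s := s) l')
      convert this using 2
      ring

theorem span_orderedMonomial [LinearOrder (PBWGen ε)] :
    Submodule.span ℂ (Set.range fun f : PBWExponent s ε => orderedMonomial s ε f.1) = ⊤ := by
  rw [eq_top_iff]
  rintro x -
  obtain ⟨w, rfl⟩ := RingQuot.mkAlgHom_surjective ℂ (TwistedRel s ε) x
  suffices h : ∃ n : ℕ, RingQuot.mkAlgHom ℂ (TwistedRel s ε) w ∈ weightFilt s ε ((n : ℤ) - 1) by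
    obtain ⟨n, hn⟩ := h
    exact weightFilt_le_span n hn
  suffices h : ∃ n : ℕ, RingQuot.mkAlgHom ℂ (TwistedRel s ε) w ∈ weightFilt s ε n by
    obtain ⟨n, hn⟩ := h
    exact ⟨n + 1, by simpa using hn⟩
  induction w using FreeAlgebra.induction with
  | grade0 c =>
    refine ⟨0, ?_⟩
    rw [AlgHom.commutes]
    exact algebraMap_mem_weightFilt c
  | grade1 g =>
    refine ⟨g.2.2, ?_⟩
    have := bInt_mem_weightFilt (s := s) (ε := ε) g.1 g.2.1 (g.2.2 : ℕ)
    rwa [bInt, freeCoeff_gen] at this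
  | mul x y hx hy =>
    obtain ⟨m, hm⟩ := hx
    obtain ⟨n, hn⟩ := hy
    refine ⟨m + n, ?_⟩
    rw [map_mul, Nat.cast_add]
    exact mul_mem_weightFilt hm hn
  | add x y hx hy =>
    obtain ⟨m, hm⟩ := hx
    obtain ⟨n, hn⟩ := hy
    refine ⟨m + n, ?_⟩
    rw [map_add]
    exact add_mem (weightFilt_mono (by simp) hm) (weightFilt_mono (by simp) hn)

end Spanning

/-! ### Solutions of the exchange relations from matrix units -/

section MatrixUnits

variable {N : ℕ} {A : Type} [Ring A] [Algebra ℂ A] {s : Fin N → ℤˣ}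

theorem superComm_const_left (i j k l : Fin N) (c : ℂ) (x : A) :
    superComm s i j k l (if i = j then algebraMap ℂ A c else 0) x = 0 := by
  rw [superComm]
  split_ifs with h
  · rw [h, CharTwo.add_self_eq_zero, zero_mul, sgn_zero, one_smul, Algebra.commutes, sub_self]
  · simp

theorem superComm_const_right (i j k l : Fin N) (c : ℂ) (x : A) :
    superComm s i j k l x (if k = l then algebraMap ℂ A c else 0) = 0 := by
  rw [superComm]
  split_ifs with h
  · rw [h, CharTwo.add_self_eq_zero, mul_zero, sgn_zero, one_smul, Algebra.commutes, sub_self]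
  · simp

variable (F : PowerSeries (Matrix (Fin N) (Fin N) A))

theorem entries_zero (h0 : PowerSeries.coeff 0 F = 1) (i j : Fin N) :
    entries F i j 0 = if i = j then algebraMap ℂ A 1 else 0 := by
  have := intCoeff_natCast F 0
  rw [Nat.cast_zero] at this
  rw [entries, this, h0, Matrix.one_apply, map_one]

omit [Algebra ℂ A] in
theorem entries_of_neg (i j : Fin N) {r : ℤ} (h : r < 0) : entries F i j r = 0 := by
  rw [entries, intCoeff_of_neg _ h]
  rfl

omit [Algebra ℂ A] in
theorem entries_natCast (i j : Fin N) (r : ℕ) : entries F i j r = PowerSeries.coeff r F i j := by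
  rw [entries, intCoeff_natCast]

variable {F}

theorem superComm_entries_left (h0 : PowerSeries.coeff 0 F = 1) (i j k l : Fin N) {p : ℤ}
    (hp : p ≤ 0) (x : A) : superComm s i j k l (entries F i j p) x = 0 := by
  rcases hp.lt_or_eq with h | rfl
  · simp [entries_of_neg F _ _ h, superComm]
  · rw [entries_zero F h0, superComm_const_left]

theorem superComm_entries_right (h0 : PowerSeries.coeff 0 F = 1) (i j k l : Fin N) {p : ℤ}
    (hp : p ≤ 0) (x : A) : superComm s i j k l x (entries F k l p) = 0 := by
  rcases hp.lt_or_eq with h | rfl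
  · simp [entries_of_neg F _ _ h, superComm]
  · rw [entries_zero F h0, superComm_const_right]

/-- A series `1 + ∑ x_{ij}^{(a)} u ^ (-a-1)` whose coefficients multiply like the elements
`(-1) ^ |i| E_{ij} t ^ a` of a current algebra satisfies the exchange relations. -/
theorem isRTT_of_matrixUnits (h0 : PowerSeries.coeff 0 F = 1)
    (h : ∀ i j k l a b, PowerSeries.coeff (a + 1) F i j * PowerSeries.coeff (b + 1) F k l =
      if j = k then sgn (parity s j) • PowerSeries.coeff (a + b + 1) F i l else 0) :
    IsRTT s F := by
  have e : ∀ i j (a : ℕ), entries F i j ((a : ℤ) + 1) = PowerSeries.coeff (a + 1) F i j :=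
    fun i j a => entries_natCast F i j (a + 1)
  have hc : ∀ i j k l (a b : ℕ), commCoeff s (entries F) i j k l ((a : ℤ) + 1) ((b : ℤ) + 1) =
      sgn₃ s i j k • ((if k = j then PowerSeries.coeff (a + b + 1) F i l else 0) -
        (if i = l then PowerSeries.coeff (a + b + 1) F k j else 0)) := by
    intro i j k l a b
    have e1 : ∀ i k : ZMod 2, i * k + i * k + k * k = k := by decide
    have e2 : ∀ i j k : ZMod 2, (i + j) * (k + i) + i = i * j + i * k + j * k := by decide
    rw [commCoeff, superComm, e, e, h, h, add_comm b a, smul_sub, sgn₃]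
    congr 1
    · by_cases hk : k = j
      · subst hk
        rw [if_pos rfl, if_pos rfl, e1]
      · rw [if_neg fun h => hk h.symm, if_neg hk, smul_zero]
    · by_cases hk : i = l
      · subst hk
        rw [if_pos rfl, if_pos rfl, smul_smul, ← sgn_add, e2]
      · rw [if_neg fun h => hk h.symm, if_neg hk, smul_zero, smul_zero]
  intro i j k l p q
  rw [rttLHS, rttRHS, exchangeCoeff]
  have left : ∀ p q, p ≤ 0 → commCoeff s (entries F) i j k l p q = 0 := fun p q hp =>
    superComm_entries_left h0 i j k l hp _
  have right : ∀ p q, q ≤ 0 → commCoeff s (entries F) i j k l p q = 0 := fun p q hp =>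
    superComm_entries_right h0 i j k l hp _
  rcases lt_or_ge p 0 with hp | hp
  · rw [left _ _ (by omega), left _ _ (by omega)]
    simp [entries_of_neg F _ _ hp]
  rcases lt_or_ge q 0 with hq | hq
  · rw [right _ _ (by omega), right _ _ (by omega)]
    simp [entries_of_neg F _ _ hq]
  lift p to ℕ using hp
  lift q to ℕ using hq
  rcases p with _ | a <;> rcases q with _ | b
  · rw [right _ ((0 : ℕ) : ℤ) (by simp), left ((0 : ℕ) : ℤ) _ (by simp)]
    simp
  · have := hc i j k l 0 b
    rw [zero_add] at this
    rw [left ((0 : ℕ) : ℤ) _ (by simp), Nat.cast_succ, this, Nat.cast_zero, entries_zero F h0,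
      entries_zero F h0, e, e, sub_zero]
    simp only [map_one, ite_mul, one_mul, zero_mul, mul_ite, mul_one, mul_zero]
  · have := hc i j k l a 0
    rw [add_zero] at this
    rw [right _ ((0 : ℕ) : ℤ) (by simp), Nat.cast_succ, this, Nat.cast_zero, entries_zero F h0,
      entries_zero F h0, e, e, zero_sub, ← smul_neg, neg_sub]
    simp only [map_one, ite_mul, one_mul, zero_mul, mul_ite, mul_one, mul_zero]
  · have h1 := hc i j k l (a + 1) b
    have h2 := hc i j k l a (b + 1)
    push_cast at h1 h2 ⊢
    rw [h1, h2, e, e, e, e, h, h, add_comm b a, sub_self, show a + 1 + b = a + (b + 1) by ring,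
      sub_self, smul_zero]

end MatrixUnits

/-! ### Representations of the super Yangian -/

/-- The letter `(i, j, a)` stands for `E_{ij} t ^ a`. -/
abbrev Letter (N : ℕ) : Type := Fin N × Fin N × ℕ

/-- The algebra of linear operators on the vector space with basis `I`. This is a type of its own,
rather than an abbreviation, so that power series of matrices of operators elaborate quickly. -/
def Op (I : Type) : Type := Module.End ℂ (I →₀ ℂ)

namespace Op

variable {I : Type}

instance : Ring (Op I) := inferInstanceAs (Ring (Module.End ℂ (I →₀ ℂ)))

instance : Algebra ℂ (Op I) := inferInstanceAs (Algebra ℂ (Module.End ℂ (I →₀ ℂ)))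

/-- The linear map underlying an operator. -/
def toEnd (X : Op I) : Module.End ℂ (I →₀ ℂ) := X

/-- The operator given by a linear map. -/
def mk (f : Module.End ℂ (I →₀ ℂ)) : Op I := f

instance : FunLike (Op I) (I →₀ ℂ) (I →₀ ℂ) :=
  inferInstanceAs (FunLike ((I →₀ ℂ) →ₗ[ℂ] (I →₀ ℂ)) (I →₀ ℂ) (I →₀ ℂ))

instance : LinearMapClass (Op I) ℂ (I →₀ ℂ) (I →₀ ℂ) :=
  inferInstanceAs (LinearMapClass ((I →₀ ℂ) →ₗ[ℂ] (I →₀ ℂ)) ℂ (I →₀ ℂ) (I →₀ ℂ))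

variable (X Y : Op I) (v : I →₀ ℂ) (c : ℂ)

@[simp] theorem mk_apply (f : Module.End ℂ (I →₀ ℂ)) : mk f v = f v := rfl

@[simp] theorem toEnd_apply : X.toEnd v = X v := rfl

@[simp] theorem mul_apply : (X * Y) v = X (Y v) := rfl

@[simp] theorem one_apply : (1 : Op I) v = v := rfl

@[simp] theorem zero_apply : (0 : Op I) v = 0 := rfl

@[simp] theorem add_apply : (X + Y) v = X v + Y v := rfl

@[simp] theorem sub_apply : (X - Y) v = X v - Y v := rfl

@[simp] theorem smul_apply : (c • X) v = c • X v := rfl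

end Op

section OneSite

variable {N : ℕ} {I M : Type} [AddCommGroup M] [Module ℂ M]

/-- The pure tensor `x ⊗ v`. Here `none` and `some (i, j, a)` are the basis elements `1` and
`E_{ij} t ^ a` of the matrix current algebra with a unit adjoined, and the basis of a tensor product
consists of pairs. -/
def tens (x : Option (Letter N)) : (I →₀ ℂ) →ₗ[ℂ] (Option (Letter N) × I →₀ ℂ) :=
  Finsupp.lmapDomain ℂ ℂ (Prod.mk x)

theorem tens_single (x : Option (Letter N)) (w : I) (c : ℂ) :
    tens x (Finsupp.single w c) = Finsupp.single (x, w) c := by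
  simp [tens]

theorem tens_hom_ext {f g : (Option (Letter N) × I →₀ ℂ) →ₗ[ℂ] M}
    (h : ∀ x v, f (tens x v) = g (tens x v)) : f = g := by
  refine Finsupp.lhom_ext fun ⟨x, w⟩ c => ?_
  rw [← tens_single, h]

/-- The linear map with given values on pure tensors. -/
def tensLift (φ : Option (Letter N) → (I →₀ ℂ) →ₗ[ℂ] M) :
    (Option (Letter N) × I →₀ ℂ) →ₗ[ℂ] M :=
  Finsupp.linearCombination ℂ fun y => φ y.1 (Finsupp.single y.2 1)

@[simp] theorem tensLift_tens (φ : Option (Letter N) → (I →₀ ℂ) →ₗ[ℂ] M)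
    (x : Option (Letter N)) (v : I →₀ ℂ) : tensLift φ (tens x v) = φ x v := by
  have : tensLift φ ∘ₗ tens x = φ x := by
    refine Finsupp.lhom_ext fun w c => ?_
    rw [LinearMap.comp_apply, tens_single, tensLift, Finsupp.linearCombination_single,
      ← map_smul, Finsupp.smul_single_one]
  exact LinearMap.congr_fun this v

theorem Op.ext {X Y : Op (Option (Letter N) × I)} (h : ∀ x v, X (tens x v) = Y (tens x v)) :
    X = Y :=
  tens_hom_ext (f := X.toEnd) (g := Y.toEnd) h

/-- The parity of a basis element of one tensor factor. -/
def stateParity (s : Fin N → ℤˣ) : Option (Letter N) → ZMod 2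
  | none => 0
  | some g => parity s g.1 + parity s g.2.1

/-- Left multiplication by `E_{ij} t ^ a` in the first tensor factor. -/
def siteOp (g : Letter N) : Op (Option (Letter N) × I) :=
  Op.mk <| tensLift fun x => match x with
    | none => tens (some g)
    | some h => if g.2.1 = h.1 then tens (some (g.1, h.2.1, g.2.2 + h.2.2)) else 0

/-- The operator `1 ⊗ X` for an operator `X` of parity `p`, with the sign rule. -/
def pass (s : Fin N → ℤˣ) (p : ZMod 2) :
    Op I →ₗ[ℂ] Op (Option (Letter N) × I) where
  toFun X := Op.mk (tensLift fun x => sgn (p * stateParity s x) • (tens x ∘ₗ X.toEnd))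
  map_add' X Y := Op.ext fun x v => by simp
  map_smul' c X := Op.ext fun x v => by simp [smul_comm c]

variable (s : Fin N → ℤˣ)

@[simp] theorem siteOp_none (g : Letter N) (v : I →₀ ℂ) :
    siteOp g (tens none v) = tens (some g) v := by simp [siteOp]

@[simp] theorem siteOp_some (g h : Letter N) (v : I →₀ ℂ) :
    siteOp g (tens (some h) v) =
      if g.2.1 = h.1 then tens (some (g.1, h.2.1, g.2.2 + h.2.2)) v else 0 := by
  simp only [siteOp, Op.mk_apply, tensLift_tens]
  split_ifs <;> rfl

@[simp] theorem pass_tens (p : ZMod 2) (X : Op I) (x : Option (Letter N))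
    (v : I →₀ ℂ) : pass s p X (tens x v) = sgn (p * stateParity s x) • tens x (X v) := by
  simp [pass]

theorem siteOp_mul (g h : Letter N) : (siteOp g * siteOp h :
    Op (Option (Letter N) × I)) =
      if g.2.1 = h.1 then siteOp (g.1, h.2.1, g.2.2 + h.2.2) else 0 := by
  refine Op.ext fun x v => ?_
  rw [Op.mul_apply]
  cases x with
  | none => split_ifs with h1 <;> simp [h1]
  | some k =>
    rw [siteOp_some]
    by_cases h1 : g.2.1 = h.1 <;> by_cases h2 : h.2.1 = k.1 <;> simp [h1, h2, add_assoc]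

theorem pass_mul (p q : ZMod 2) (X Y : Op I) :
    pass s p X * pass s q Y = pass s (p + q) (X * Y) := by
  refine Op.ext fun x v => ?_
  rw [Op.mul_apply, pass_tens, map_smul, pass_tens, pass_tens, smul_smul, ← sgn_add,
    Op.mul_apply, add_mul, add_comm]

theorem pass_one : pass s 0 (1 : Op I) = 1 :=
  Op.ext fun x v => by simp

theorem siteOp_mul_pass (g : Letter N) (p : ZMod 2) (X : Op I) :
    siteOp g * pass s p X =
      sgn ((parity s g.1 + parity s g.2.1) * p) • (pass s p X * siteOp g) := by
  refine Op.ext fun x v => ?_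
  rw [Op.mul_apply, pass_tens, map_smul, Op.smul_apply, Op.mul_apply]
  cases x with
  | none =>
    rw [siteOp_none, siteOp_none, pass_tens, smul_smul, ← sgn_add]
    simp only [stateParity]
    rw [mul_zero, mul_comm p, CharTwo.add_self_eq_zero]
  | some h =>
    rw [siteOp_some, siteOp_some]
    split_ifs with h1
    · rw [pass_tens, smul_smul, ← sgn_add]
      have e : ∀ a b c p : ZMod 2, (a + b) * p + p * (a + c) = p * (b + c) := by decide
      simp only [stateParity, e, h1]
    · simp

/-- The solution `1 + ∑ (-1)^|i| E_{ij} t^a u^{-a-1}` of the exchange relations. -/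
def siteSeries (I : Type) :
    PowerSeries (Matrix (Fin N) (Fin N) (Op (Option (Letter N) × I))) :=
  PowerSeries.mk fun r => match r with
    | 0 => 1
    | a + 1 => Matrix.of fun i j => sgn (parity s i) • siteOp (i, j, a)

theorem coeff_zero_siteSeries : PowerSeries.coeff 0 (siteSeries s I) = 1 := by
  simp [siteSeries]

theorem coeff_succ_siteSeries (a : ℕ) (i j : Fin N) :
    PowerSeries.coeff (a + 1) (siteSeries s I) i j = sgn (parity s i) • siteOp (i, j, a) := by
  simp [siteSeries]

theorem isRTT_siteSeries : IsRTT s (siteSeries s I) := by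
  refine isRTT_of_matrixUnits (coeff_zero_siteSeries s) fun i j k l a b => ?_
  rw [coeff_succ_siteSeries, coeff_succ_siteSeries, smul_mul_smul_comm, siteOp_mul]
  split_ifs with h
  · simp only at h
    rw [coeff_succ_siteSeries, h, smul_smul, mul_comm]
  · simp

/-- The entrywise application of `pass`. -/
def passSeries (F : PowerSeries (Matrix (Fin N) (Fin N) (Op I))) :
    PowerSeries (Matrix (Fin N) (Fin N) (Op (Option (Letter N) × I))) :=
  PowerSeries.mk fun r => Matrix.of fun i j =>
    pass s (parity s i + parity s j) (PowerSeries.coeff r F i j)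

theorem coeff_passSeries (F : PowerSeries (Matrix (Fin N) (Fin N) (Op I)))
    (r : ℕ) (i j : Fin N) : PowerSeries.coeff r (passSeries s F) i j =
      pass s (parity s i + parity s j) (PowerSeries.coeff r F i j) := by
  simp [passSeries]

theorem coeff_zero_passSeries {F : PowerSeries (Matrix (Fin N) (Fin N) (Op I))}
    (h0 : PowerSeries.coeff 0 F = 1) : PowerSeries.coeff 0 (passSeries s F) = 1 := by
  ext1 i j
  rw [coeff_passSeries, h0, Matrix.one_apply, Matrix.one_apply]
  split_ifs with h
  · rw [h, CharTwo.add_self_eq_zero, pass_one]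
  · simp

theorem entries_passSeries (F : PowerSeries (Matrix (Fin N) (Fin N) (Op I)))
    (i j : Fin N) (r : ℤ) : entries (passSeries s F) i j r =
      pass s (parity s i + parity s j) (entries F i j r) := by
  rcases lt_or_ge r 0 with h | h
  · rw [entries_of_neg _ _ _ h, entries_of_neg _ _ _ h, map_zero]
  · lift r to ℕ using h
    rw [entries_natCast, entries_natCast, coeff_passSeries]

variable {s} in
theorem IsRTT.passSeries {F : PowerSeries (Matrix (Fin N) (Fin N) (Op I))}
    (hF : IsRTT s F) : IsRTT s (passSeries s F) := by
  intro i j k l p q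
  have hc : ∀ p q, commCoeff s (entries (SuperYangian.passSeries s F)) i j k l p q =
      pass s (parity s i + parity s j + (parity s k + parity s l))
        (commCoeff s (entries F) i j k l p q) := by
    intro p q
    rw [commCoeff, commCoeff, superComm, superComm, entries_passSeries, entries_passSeries,
      pass_mul, pass_mul, map_sub, map_smul, add_comm (parity s k + parity s l)]
  have e1 : ∀ i j k l : ZMod 2, k + j + (i + l) = i + j + (k + l) := by decide
  have h := congrArg (pass s (parity s i + parity s j + (parity s k + parity s l)))
    (hF i j k l p q)
  rw [rttLHS, rttRHS, exchangeCoeff, map_sub, map_smul, map_sub] at h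
  rw [rttLHS, rttRHS, exchangeCoeff, hc, hc]
  simp only [entries_passSeries]
  rw [pass_mul, pass_mul, e1 (parity s i)]
  exact h

theorem superComm_site_pass (F : PowerSeries (Matrix (Fin N) (Fin N) (Op I)))
    (i j k l : Fin N) (p q : ℤ) :
    superComm s i j k l (entries (siteSeries s I) i j p) (entries (passSeries s F) k l q) = 0 := by
  rcases le_or_gt p 0 with h | h
  · exact superComm_entries_left (F := siteSeries s I) (coeff_zero_siteSeries s) i j k l h _
  · obtain ⟨a, rfl⟩ : ∃ a : ℕ, p = ((a + 1 : ℕ) : ℤ) := ⟨p.toNat - 1, by omega⟩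
    rw [superComm, entries_natCast, coeff_succ_siteSeries, entries_passSeries, smul_mul_assoc,
      siteOp_mul_pass, mul_smul_comm, smul_comm, sub_self]

theorem superComm_pass_site (F : PowerSeries (Matrix (Fin N) (Fin N) (Op I)))
    (i j k l : Fin N) (p q : ℤ) :
    superComm s i j k l (entries (passSeries s F) i j p) (entries (siteSeries s I) k l q) = 0 := by
  have h := superComm_site_pass s F k l i j q p
  rw [superComm, sub_eq_zero] at h
  rw [superComm, h, smul_smul, mul_comm (parity s i + parity s j), sgn_mul_self, one_smul,
    sub_self]

end OneSite

section Rep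

variable {N : ℕ} (s : Fin N → ℤˣ)

/-- The basis of the `d`-fold tensor power. -/
def Site (N : ℕ) : ℕ → Type
  | 0 => Unit
  | d + 1 => Option (Letter N) × Site N d

/-- The solution of the exchange relations on the `d`-fold tensor power, given by the coproduct. -/
def repSeries : (d : ℕ) → PowerSeries (Matrix (Fin N) (Fin N) (Op (Site N d)))
  | 0 => 1
  | d + 1 => siteSeries s (Site N d) * passSeries s (repSeries d)

theorem coeff_zero_mul_eq_one {R : Type} [Ring R] {f g : PowerSeries R}
    (hf : PowerSeries.coeff 0 f = 1) (hg : PowerSeries.coeff 0 g = 1) :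
    PowerSeries.coeff 0 (f * g) = 1 := by
  rw [PowerSeries.coeff_zero_eq_constantCoeff_apply] at *
  rw [map_mul, hf, hg, one_mul]

theorem coeff_zero_repSeries (d : ℕ) : PowerSeries.coeff 0 (repSeries s d) = 1 := by
  induction d with
  | zero => simp [repSeries]
  | succ d ih =>
    exact coeff_zero_mul_eq_one (coeff_zero_siteSeries s) (coeff_zero_passSeries s ih)

theorem isRTT_repSeries (d : ℕ) : IsRTT s (repSeries s d) := by
  induction d with
  | zero =>
    have h : ∀ a : ℕ, PowerSeries.coeff (a + 1) (repSeries s 0) = 0 := fun a => by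
      rw [repSeries, PowerSeries.coeff_one, if_neg (Nat.succ_ne_zero a)]
    refine isRTT_of_matrixUnits (coeff_zero_repSeries s 0) fun i j k l a b => ?_
    rw [h, h, h]
    simp
  | succ d ih =>
    exact (isRTT_siteSeries s).mul ih.passSeries (superComm_site_pass s _)
      (superComm_pass_site s _)

/-- The representation of the super Yangian on the `d`-fold tensor power. -/
def rep (d : ℕ) : Yangian s →ₐ[ℂ] Op (Site N d) :=
  yangianLift s (repSeries s d) (isRTT_repSeries s d) (coeff_zero_repSeries s d)

theorem rep_T (d r : ℕ) (i j : Fin N) :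
    rep s d (PowerSeries.coeff r (T s) i j) = PowerSeries.coeff r (repSeries s d) i j := by
  rw [T, PowerSeries.coeff_mk]
  exact yangianLift_tCoeff s _ _ i j r

end Rep

/-! ### Filtrations and leading terms -/

section Filtration

variable {N : ℕ} {A : Type} [Ring A] [Algebra ℂ A]

/-- A multiplicative increasing filtration of an algebra. -/
structure IsFiltration (Φ : ℤ → Submodule ℂ A) : Prop where
  mono : ∀ {m n}, m ≤ n → Φ m ≤ Φ n
  mul_mem : ∀ {m n x y}, x ∈ Φ m → y ∈ Φ n → x * y ∈ Φ (m + n)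

/-- All entries of a matrix lie in the `n`-th step of a filtration. -/
def MatMem (Φ : ℤ → Submodule ℂ A) (n : ℤ) (X : Matrix (Fin N) (Fin N) A) : Prop :=
  ∀ i j, X i j ∈ Φ n

variable {Φ : ℤ → Submodule ℂ A}

theorem IsFiltration.matMem_mul (h : IsFiltration Φ) {m n k : ℤ} {X Y : Matrix (Fin N) (Fin N) A}
    (hX : MatMem Φ m X) (hY : MatMem Φ n Y) (hk : m + n ≤ k) : MatMem Φ k (X * Y) := by
  intro i j
  rw [Matrix.mul_apply]
  exact Submodule.sum_mem _ fun a _ => h.mono hk (h.mul_mem (hX i a) (hY a j))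

/-- If the coefficients of `F` and `G` at `u ^ (-b-1)` have degree at most `2 b + 1`, then in the
coefficient of `F * G` at `u ^ (-a-1)` only the two products with a constant coefficient can have
degree more than `2 a`. -/
theorem IsFiltration.coeff_succ_mul (h : IsFiltration Φ)
    {F G : PowerSeries (Matrix (Fin N) (Fin N) A)} {a : ℕ}
    (hF : ∀ b < a, MatMem Φ (2 * b + 1) (PowerSeries.coeff (b + 1) F))
    (hG : ∀ b < a, MatMem Φ (2 * b + 1) (PowerSeries.coeff (b + 1) G)) :
    MatMem Φ (2 * a) (PowerSeries.coeff (a + 1) (F * G) -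
      (PowerSeries.coeff (a + 1) F * PowerSeries.coeff 0 G +
        PowerSeries.coeff 0 F * PowerSeries.coeff (a + 1) G)) := by
  have m1 : (a, 0) ∈ Finset.HasAntidiagonal.antidiagonal a := by simp
  rw [PowerSeries.coeff_mul, Finset.Nat.sum_antidiagonal_succ, ← Finset.add_sum_erase _ _ m1,
    show ∀ x y z : Matrix (Fin N) (Fin N) A, x + (y + z) - (y + x) = z from
      fun x y z => by abel]
  intro i j
  rw [Matrix.sum_apply]
  refine Submodule.sum_mem _ fun d hd => ?_
  simp only [Finset.mem_erase, Finset.HasAntidiagonal.mem_antidiagonal, ne_eq] at hd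
  obtain ⟨h1, h2⟩ := hd
  obtain ⟨b, c⟩ := d
  cases c with
  | zero => exact absurd (Prod.ext (by simpa using h2) rfl : ((b, 0) : ℕ × ℕ) = (a, 0)) h1
  | succ c =>
    simp only at h2
    exact h.matMem_mul (hF b (by omega)) (hG c (by omega)) (by omega) i j

variable {s : Fin N → ℤˣ}

/-- The leading part of `T⁻¹(u)` is the negative of that of `T(u)`. -/
theorem coeff_TInv_leading {Φ : ℤ → Submodule ℂ (Yangian s)} (h : IsFiltration Φ)
    (hT : ∀ a : ℕ, MatMem Φ (2 * a + 1) (PowerSeries.coeff (a + 1) (T s))) (a : ℕ) :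
    MatMem Φ (2 * a) (PowerSeries.coeff (a + 1) (T s) + PowerSeries.coeff (a + 1) (TInv s)) ∧
      MatMem Φ (2 * a + 1) (PowerSeries.coeff (a + 1) (TInv s)) := by
  induction a using Nat.strong_induction_on with
  | _ a ih =>
    have h1 := h.coeff_succ_mul (a := a) (fun b _ => hT b) fun b hb => (ih b hb).2
    rw [T_mul_TInv, PowerSeries.coeff_one, if_neg (Nat.succ_ne_zero a), coeff_zero_TInv,
      PowerSeries.coeff_zero_eq_constantCoeff_apply, constantCoeff_T, mul_one, one_mul,
      zero_sub] at h1
    have h2 : MatMem Φ (2 * a) (PowerSeries.coeff (a + 1) (T s) +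
        PowerSeries.coeff (a + 1) (TInv s)) := fun i j => by
      have := neg_mem (h1 i j)
      rwa [← Matrix.neg_apply, neg_neg] at this
    refine ⟨h2, fun i j => ?_⟩
    have := sub_mem (h.mono (by omega) (h2 i j)) (hT a i j)
    rwa [Matrix.add_apply, add_sub_cancel_left] at this

theorem coeff_negArg_smul {R : Type} [Ring R] [Module ℂ R] (f : PowerSeries R) (r : ℕ) :
    PowerSeries.coeff r (negArg f) = (-1 : ℂ) ^ r • PowerSeries.coeff r f := by
  rw [coeff_negArg]
  rcases Nat.even_or_odd r with h | h
  · rw [h.neg_one_pow, h.neg_one_pow, one_mul, one_smul]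
  · rw [h.neg_one_pow, h.neg_one_pow, neg_one_mul, neg_smul, one_smul]

/-- Up to smaller degree, `b_{ij}^{(a+1)}` maps to `(ε_j + (-1) ^ a ε_i) t_{ij}^{(a+1)}`; the scalar
does not vanish for the generators of the basis theorem. -/
theorem coeff_TGT_leading {Φ : ℤ → Submodule ℂ (Yangian s)} (h : IsFiltration Φ)
    (hT : ∀ a : ℕ, MatMem Φ (2 * a + 1) (PowerSeries.coeff (a + 1) (T s))) (ε : Fin N → ℤˣ)
    (i j : Fin N) (a : ℕ) :
    PowerSeries.coeff (a + 1) (TGT s ε) i j -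
      (((ε j : ℤ) : ℂ) + (-1) ^ a * ((ε i : ℤ) : ℂ)) • PowerSeries.coeff (a + 1) (T s) i j ∈
        Φ (2 * a) := by
  have hc : ∀ r i j, PowerSeries.coeff r (T s * G s ε) i j =
      ((ε j : ℤ) : ℂ) • PowerSeries.coeff r (T s) i j := by
    intro r i j
    rw [G, PowerSeries.coeff_mul_C, Matrix.mul_diagonal, ← (Int.cast_commute _ _).eq,
      Algebra.smul_def, map_intCast]
  have hn : ∀ r i j, PowerSeries.coeff r (negArg (TInv s)) i j =
      ((-1 : ℂ) ^ r) • PowerSeries.coeff r (TInv s) i j := by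
    intro r i j
    suffices e : PowerSeries.coeff r (negArg (TInv s)) =
        (-1 : ℂ) ^ r • PowerSeries.coeff r (TInv s) by rw [e, Matrix.smul_apply]
    exact coeff_negArg_smul _ r
  have h1 := h.coeff_succ_mul (F := T s * G s ε) (G := negArg (TInv s)) (a := a)
    (fun b _ i j => by rw [hc]; exact Submodule.smul_mem _ _ (hT b i j))
    (fun b _ i j => by
      rw [hn]; exact Submodule.smul_mem _ _ ((coeff_TInv_leading h hT b).2 i j)) i j
  have e1 : PowerSeries.coeff 0 (negArg (TInv s)) = 1 := by
    rw [coeff_negArg, coeff_zero_TInv]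
    simp
  have e2 : PowerSeries.coeff 0 (T s * G s ε) =
      Matrix.diagonal fun i => ((ε i : ℤ) : Yangian s) := by
    rw [PowerSeries.coeff_zero_eq_constantCoeff_apply, map_mul, constantCoeff_T, G]
    simp
  rw [e1, e2, mul_one, Matrix.sub_apply, Matrix.add_apply, Matrix.diagonal_mul, hc, hn,
    ← map_intCast (algebraMap ℂ (Yangian s)), ← Algebra.smul_def] at h1
  have h2 := Submodule.smul_mem _ (((ε i : ℤ) : ℂ) * (-1) ^ (a + 1))
    ((coeff_TInv_leading h hT a).1 i j)
  have h3 := add_mem h1 h2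
  rw [TGT]
  convert h3 using 1
  rw [Matrix.add_apply]
  module

end Filtration

/-! ### The degree on the tensor powers -/

section Degree

variable {N : ℕ} {I : Type}

/-- The span of the basis elements of degree at most `m`. -/
def degLE (deg : I → ℤ) (m : ℤ) : Submodule ℂ (I →₀ ℂ) :=
  Finsupp.supported ℂ ℂ {x | deg x ≤ m}

theorem degLE_mono (deg : I → ℤ) {m n : ℤ} (h : m ≤ n) : degLE deg m ≤ degLE deg n :=
  Finsupp.supported_mono fun _ hx => le_trans hx h

theorem degLE_le {deg : I → ℤ} {m : ℤ} {S : Submodule ℂ (I →₀ ℂ)}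
    (h : ∀ x, deg x ≤ m → Finsupp.single x 1 ∈ S) : degLE deg m ≤ S := by
  rw [degLE, Finsupp.supported_eq_span_single, Submodule.span_le]
  rintro _ ⟨x, hx, rfl⟩
  exact h x hx

theorem single_mem_degLE {deg : I → ℤ} {m : ℤ} {x : I} (h : deg x ≤ m) (c : ℂ) :
    Finsupp.single x c ∈ degLE deg m :=
  Finsupp.single_mem_supported ℂ c h

/-- Operators raising the degree by at most `n`. -/
def opFilt (deg : I → ℤ) (n : ℤ) : Submodule ℂ (Op I) where
  carrier := {X | ∀ m v, v ∈ degLE deg m → X v ∈ degLE deg (m + n)}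
  add_mem' hX hY m v hv := add_mem (hX m v hv) (hY m v hv)
  zero_mem' _ _ _ := zero_mem _
  smul_mem' c _ hX m v hv := Submodule.smul_mem _ c (hX m v hv)

theorem opFilt_isFiltration (deg : I → ℤ) : IsFiltration (opFilt deg) where
  mono h _ hX _ _ hv := degLE_mono deg (by omega) (hX _ _ hv)
  mul_mem {m n _ _} hX hY k v hv := by
    have := hX _ _ (hY k v hv)
    rwa [add_assoc, add_comm n m] at this

/-- The degree of `E_{ij} t ^ a`. -/
def letterDeg (g : Letter N) : ℤ := 2 * g.2.2 + 1

/-- The degree of a state of one tensor factor. -/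
def stateDeg : Option (Letter N) → ℤ
  | none => 0
  | some g => letterDeg g

/-- The degree of a basis element of a tensor product. -/
def pairDeg (deg : I → ℤ) (x : Option (Letter N) × I) : ℤ := stateDeg x.1 + deg x.2

theorem tens_mem_degLE {deg : I → ℤ} {m : ℤ} {v : I →₀ ℂ} (hv : v ∈ degLE deg m)
    (x : Option (Letter N)) : tens x v ∈ degLE (pairDeg deg) (stateDeg x + m) := by
  have h : degLE deg m ≤ (degLE (pairDeg deg) (stateDeg x + m)).comap (tens x) := by
    refine degLE_le fun w hw => ?_
    rw [Submodule.mem_comap, tens_single]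
    refine single_mem_degLE (deg := pairDeg deg) (x := (x, w)) ?_ 1
    simp only [pairDeg]
    omega
  exact h hv

theorem mem_opFilt_pair {deg : I → ℤ} {n : ℤ} {X : Op (Option (Letter N) × I)}
    (h : ∀ x m v, v ∈ degLE deg m → X (tens x v) ∈ degLE (pairDeg deg) (stateDeg x + m + n)) :
    X ∈ opFilt (pairDeg deg) n := by
  intro m v hv
  have h' : degLE (pairDeg deg) m ≤ (degLE (pairDeg deg) (m + n)).comap X.toEnd := by
    refine degLE_le fun x hx => ?_
    rw [Submodule.mem_comap, ← tens_single, Op.toEnd_apply]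
    refine degLE_mono _ ?_ (h x.1 (deg x.2) _ (single_mem_degLE le_rfl 1))
    simp only [pairDeg] at hx
    omega
  exact h' hv

/-- The leading part of `siteOp g`: it maps `1 ⊗ v` to `g ⊗ v`, and kills `h ⊗ v`. -/
def createOp (g : Letter N) : Op (Option (Letter N) × I) :=
  Op.mk <| tensLift fun x => match x with
    | none => tens (some g)
    | some _ => 0

@[simp] theorem createOp_none (g : Letter N) (v : I →₀ ℂ) :
    createOp g (tens none v) = tens (some g) v := by simp [createOp]

@[simp] theorem createOp_some (g h : Letter N) (v : I →₀ ℂ) :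
    createOp g (tens (some h) v) = 0 := by simp [createOp]

theorem createOp_mem (deg : I → ℤ) (g : Letter N) :
    createOp g ∈ opFilt (pairDeg deg) (letterDeg g) := by
  refine mem_opFilt_pair fun x m v hv => ?_
  cases x with
  | none =>
    rw [createOp_none]
    refine degLE_mono _ ?_ (tens_mem_degLE hv (some g))
    simp only [stateDeg]
    omega
  | some h =>
    rw [createOp_some]
    exact zero_mem _

/-- Multiplying `E_{ij} t ^ a` with an occupied tensor factor raises the degree by `2 a` only, which
is one less than creating it in an empty one. -/
theorem siteOp_sub_createOp_mem (deg : I → ℤ) (g : Letter N) :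
    siteOp g - createOp g ∈ opFilt (pairDeg deg) (2 * g.2.2) := by
  refine mem_opFilt_pair fun x m v hv => ?_
  cases x with
  | none => simp
  | some h =>
    rw [Op.sub_apply, createOp_some, sub_zero, siteOp_some]
    split_ifs
    · refine degLE_mono _ ?_ (tens_mem_degLE hv _)
      simp only [stateDeg, letterDeg]
      omega
    · exact zero_mem _

theorem pass_mem (s : Fin N → ℤˣ) {deg : I → ℤ} (p : ZMod 2) {n : ℤ} {X : Op I}
    (hX : X ∈ opFilt deg n) : pass s p X ∈ opFilt (pairDeg deg) n := by
  refine mem_opFilt_pair fun x m v hv => ?_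
  rw [pass_tens]
  refine Submodule.smul_mem _ _ ?_
  rw [add_assoc]
  exact tens_mem_degLE (hX m v hv) x

variable (s : Fin N → ℤˣ)

/-- The degree of a basis element of the `d`-fold tensor power. -/
def siteDeg : (d : ℕ) → Site N d → ℤ
  | 0 => fun _ => 0
  | d + 1 => pairDeg (siteDeg d)

/-- The parity of the letter `E_{ij} t ^ a`. -/
def letterParity (g : Letter N) : ZMod 2 := parity s g.1 + parity s g.2.1

/-- The leading part of `(-1) ^ |i| t_{ij}^{(a+1)}` on the `d`-fold tensor power: it creates the
letter `g = (i, j, a)` in an empty tensor factor. -/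
def leadOp : (d : ℕ) → Letter N → Op (Site N d)
  | 0 => fun _ => 0
  | d + 1 => fun g =>
    (createOp g + pass s (letterParity s g) (leadOp d g) : Op (Option (Letter N) × Site N d))

theorem leadOp_mem (d : ℕ) (g : Letter N) :
    leadOp s d g ∈ opFilt (siteDeg d) (letterDeg g) := by
  induction d with
  | zero => exact zero_mem _
  | succ d ih => exact add_mem (createOp_mem _ g) (pass_mem s _ ih)

/-- The leading part of the coefficients of the solution with one more tensor factor. -/
theorem leading_step (F : PowerSeries (Matrix (Fin N) (Fin N) (Op I))) (deg : I → ℤ)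
    (h0 : PowerSeries.coeff 0 F = 1) (y : Letter N → Op I)
    (hy : ∀ g, y g ∈ opFilt deg (letterDeg g))
    (hF : ∀ i j (a : ℕ), PowerSeries.coeff (a + 1) F i j - sgn (parity s i) • y (i, j, a) ∈
      opFilt deg (2 * a)) (i j : Fin N) (a : ℕ) :
    PowerSeries.coeff (a + 1) (siteSeries s I * passSeries s F) i j -
      sgn (parity s i) • (createOp (i, j, a) + pass s (letterParity s (i, j, a)) (y (i, j, a))) ∈
        opFilt (pairDeg deg) (2 * a) := by
  have hP := opFilt_isFiltration (pairDeg (N := N) deg)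
  have h1 : ∀ (a : ℕ) i j, siteOp (i, j, a) ∈ opFilt (pairDeg (N := N) deg) (2 * a + 1) := by
    intro a i j
    have := add_mem
      (hP.mono (by simp only [letterDeg]; omega) (siteOp_sub_createOp_mem deg (i, j, a)))
      (createOp_mem deg (i, j, a))
    rwa [sub_add_cancel] at this
  have h2 : ∀ (a : ℕ) i j, PowerSeries.coeff (a + 1) F i j ∈ opFilt deg (2 * a + 1) := by
    intro a i j
    have := add_mem ((opFilt_isFiltration deg).mono (by simp only [letterDeg]; omega) (hF i j a))
      (Submodule.smul_mem _ (sgn (parity s i)) (hy (i, j, a)))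
    rwa [sub_add_cancel] at this
  have h3 := hP.coeff_succ_mul (F := siteSeries s I) (G := passSeries s F) (a := a)
    (fun b _ i j => by
      rw [coeff_succ_siteSeries]; exact Submodule.smul_mem _ _ (h1 b i j))
    (fun b _ i j => by rw [coeff_passSeries]; exact pass_mem s _ (h2 b i j)) i j
  rw [coeff_zero_siteSeries, coeff_zero_passSeries s h0, mul_one, one_mul, Matrix.sub_apply,
    Matrix.add_apply, coeff_succ_siteSeries, coeff_passSeries] at h3
  have h4 := add_mem (add_mem h3 (Submodule.smul_mem _ (sgn (parity s i))
    (siteOp_sub_createOp_mem deg (i, j, a)))) (pass_mem s (parity s i + parity s j) (hF i j a))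
  rw [map_sub, map_smul] at h4
  convert h4 using 1
  simp only [letterParity]
  module

theorem repSeries_leading (d : ℕ) (i j : Fin N) (a : ℕ) :
    PowerSeries.coeff (a + 1) (repSeries s d) i j - sgn (parity s i) • leadOp s d (i, j, a) ∈
      opFilt (siteDeg d) (2 * a) := by
  induction d generalizing i j a with
  | zero =>
    rw [repSeries, PowerSeries.coeff_one, if_neg (Nat.succ_ne_zero a), leadOp, smul_zero]
    exact sub_mem (zero_mem _) (zero_mem _)
  | succ d ih =>
    exact leading_step s (repSeries s d) (siteDeg d) (coeff_zero_repSeries s d) (leadOp s d)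
      (leadOp_mem s d) ih i j a

/-- The letter `E_{ij} t ^ (r-1)` of the generator `b_{ij}^{(r)}`. -/
def PBWGen.letter {ε : Fin N → ℤˣ} (g : PBWGen ε) : Letter N := (g.i, g.j, g.r.natPred)

theorem rep_phi_leading {ε : Fin N → ℤˣ} (d : ℕ) (g : PBWGen ε) :
    ∃ c : ℂ, c ≠ 0 ∧ rep s d (phi s ε (bCoeff s ε g.i g.j g.r)) - c • leadOp s d g.letter ∈
      opFilt (siteDeg d) (letterDeg g.letter - 1) := by
  obtain ⟨i, j, r, hr⟩ := g
  obtain ⟨a, rfl⟩ : ∃ a : ℕ, r = a.succPNat := ⟨r.natPred, by simp⟩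
  have hΦ : IsFiltration fun n => (opFilt (siteDeg d) n).comap (rep s d).toLinearMap := {
    mono := fun h => Submodule.comap_mono ((opFilt_isFiltration _).mono h)
    mul_mem := fun {m n x y} hx hy => by
      have := (opFilt_isFiltration (siteDeg d)).mul_mem hx hy
      rw [Submodule.mem_comap]
      exact (map_mul (rep s d) x y).symm ▸ this }
  have hT : ∀ a : ℕ, MatMem (fun n => (opFilt (siteDeg d) n).comap (rep s d).toLinearMap)
      (2 * a + 1) (PowerSeries.coeff (a + 1) (T s)) := by
    intro a i j
    change rep s d _ ∈ opFilt (siteDeg d) (2 * a + 1)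
    rw [rep_T]
    have := add_mem ((opFilt_isFiltration (siteDeg d)).mono (by simp only [letterDeg]; omega)
      (repSeries_leading s d i j a))
      (Submodule.smul_mem _ (sgn (parity s i)) (leadOp_mem s d (i, j, a)))
    rwa [sub_add_cancel] at this
  have h1 := coeff_TGT_leading hΦ hT ε i j a
  change rep s d (_ - _) ∈ opFilt (siteDeg d) (2 * a) at h1
  rw [map_sub, map_smul, rep_T] at h1
  have h2 := add_mem h1 (Submodule.smul_mem _ (((ε j : ℤ) : ℂ) + (-1) ^ a * ((ε i : ℤ) : ℂ))
    (repSeries_leading s d i j a))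
  rw [smul_sub, sub_add_sub_cancel, smul_smul] at h2
  refine ⟨(((ε j : ℤ) : ℂ) + (-1) ^ a * ((ε i : ℤ) : ℂ)) * sgn (parity s i),
    mul_ne_zero ?_ (sgn_ne_zero (parity s i)), ?_⟩
  rotate_left
  · rw [phi_bCoeff]
    have e : letterDeg (PBWGen.letter (⟨i, j, a.succPNat, hr⟩ : PBWGen ε)) - 1 = 2 * a := by
      simp [letterDeg, PBWGen.letter]
    rw [e]
    exact h2
  · rw [Nat.succPNat_coe, Nat.succ_eq_add_one, Nat.odd_add_one, Nat.not_odd_iff_even,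
      Nat.even_add_one, Nat.not_even_iff_odd] at hr
    rcases hr with ⟨h, ha⟩ | ⟨h, ha⟩
    · rw [ha.neg_one_pow, h]
      rcases Int.units_eq_one_or (ε j) with h | h <;> rw [h] <;> norm_num
    · rw [ha.neg_one_pow]
      rcases Int.units_eq_one_or (ε j) with h1 | h1 <;>
        rcases Int.units_eq_one_or (ε i) with h' | h' <;> rw [h1, h'] at h ⊢ <;>
          first | exact absurd rfl h | norm_num

end Degree

/-! ### Leading coefficients of products of creation operators -/

section Creation

variable {N : ℕ} {I : Type} (s : Fin N → ℤˣ)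

/-- The component `v_x` of a vector `∑ x ⊗ v_x`. -/
def component (x : Option (Letter N)) : (Option (Letter N) × I →₀ ℂ) →ₗ[ℂ] (I →₀ ℂ) :=
  open Classical in tensLift fun x' => if x' = x then LinearMap.id else 0

theorem component_tens_self (x : Option (Letter N)) (v : I →₀ ℂ) :
    component x (tens x v) = v := by simp [component]

theorem component_tens_of_ne {x x' : Option (Letter N)} (h : x' ≠ x) (v : I →₀ ℂ) :
    component x (tens x' v) = 0 := by simp [component, h]

theorem component_apply (x : Option (Letter N)) (v : Option (Letter N) × I →₀ ℂ) (w : I) :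
    component x v w = v (x, w) := by
  have h : Finsupp.lapply w ∘ₗ component x =
      (Finsupp.lapply (x, w) : (Option (Letter N) × I →₀ ℂ) →ₗ[ℂ] ℂ) := by
    refine tens_hom_ext fun x' v => ?_
    rw [LinearMap.comp_apply, Finsupp.lapply_apply, Finsupp.lapply_apply]
    by_cases hx : x' = x
    · subst hx
      rw [component_tens_self]
      exact (Finsupp.mapDomain_apply (Prod.mk_right_injective x') v w).symm
    · rw [component_tens_of_ne hx]
      refine (Finsupp.mapDomain_of_notMem_range _ _ ?_).symm
      rintro ⟨w', hw⟩
      exact hx (congrArg Prod.fst hw)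
  exact LinearMap.congr_fun h v

/-- The operator which creates `g` in the first tensor factor or, by `y g`, in the others. With
`y = leadOp s d` it is `leadOp s (d + 1) g`. -/
def stepOp (y : Letter N → Op I) (g : Letter N) : Op (Option (Letter N) × I) :=
  createOp g + pass s (letterParity s g) (y g)

variable {s} {y : Letter N → Op I}

theorem component_none_stepOp (g : Letter N) (v : Option (Letter N) × I →₀ ℂ) :
    component none (stepOp s y g v) = y g (component none v) := by
  refine LinearMap.congr_fun (f := component none ∘ₗ (stepOp s y g).toEnd)
    (g := (y g).toEnd ∘ₗ component none) (tens_hom_ext fun x v => ?_) v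
  simp only [LinearMap.comp_apply, Op.toEnd_apply, stepOp, Op.add_apply, pass_tens, map_add,
    map_smul]
  cases x with
  | none =>
    rw [createOp_none, component_tens_of_ne (by simp), component_tens_self, component_tens_self,
      zero_add, stateParity, mul_zero, sgn_zero, one_smul]
  | some h =>
    rw [createOp_some, component_tens_of_ne (by simp), component_tens_of_ne (by simp)]
    simp

theorem component_some_stepOp_self (h : Letter N) (v : Option (Letter N) × I →₀ ℂ) :
    component (some h) (stepOp s y h v) = component none v +
      sgn (letterParity s h * letterParity s h) • y h (component (some h) v) := by
  refine LinearMap.congr_fun (f := component (some h) ∘ₗ (stepOp s y h).toEnd)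
    (g := component none + sgn (letterParity s h * letterParity s h) •
      ((y h).toEnd ∘ₗ component (some h))) (tens_hom_ext fun x v => ?_) v
  simp only [LinearMap.comp_apply, Op.toEnd_apply, stepOp, Op.add_apply, pass_tens, map_add,
    map_smul, LinearMap.add_apply, LinearMap.smul_apply]
  cases x with
  | none =>
    simp [component_tens_self, component_tens_of_ne]
  | some g =>
    by_cases hg : g = h
    · subst hg
      simp [component_tens_self, component_tens_of_ne, stateParity, letterParity]
    · simp [component_tens_of_ne, hg]

theorem component_some_stepOp_of_ne {g h : Letter N} (hg : g ≠ h)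
    (v : Option (Letter N) × I →₀ ℂ) :
    component (some h) (stepOp s y g v) =
      sgn (letterParity s g * letterParity s h) • y g (component (some h) v) := by
  refine LinearMap.congr_fun (f := component (some h) ∘ₗ (stepOp s y g).toEnd)
    (g := sgn (letterParity s g * letterParity s h) •
      ((y g).toEnd ∘ₗ component (some h))) (tens_hom_ext fun x v => ?_) v
  simp only [LinearMap.comp_apply, Op.toEnd_apply, stepOp, Op.add_apply, pass_tens, map_add,
    map_smul, LinearMap.smul_apply]
  cases x with
  | none =>
    rw [createOp_none, component_tens_of_ne (by simp [hg]), component_tens_of_ne (by simp),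
      component_tens_of_ne (by simp)]
    simp
  | some k =>
    rw [createOp_some]
    by_cases hk : k = h
    · subst hk
      rw [component_tens_self, component_tens_self]
      simp [stateParity, letterParity]
    · rw [component_tens_of_ne (by simpa using hk), component_tens_of_ne (by simpa using hk)]
      simp

theorem component_none_prod (l : List (Letter N)) (v : I →₀ ℂ) :
    component none ((l.map (stepOp s y)).prod (tens none v)) = (l.map y).prod v := by
  induction l with
  | nil => exact component_tens_self none v
  | cons g l ih =>
    rw [List.map_cons, List.prod_cons, Op.mul_apply, component_none_stepOp, ih, List.map_cons,
      List.prod_cons, Op.mul_apply]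

/-- Splitting off the first tensor factor: if it is occupied by `h`, then `h` is one of the letters
that were created, and the others were created in the remaining factors. -/
theorem component_some_prod_mem (h : Letter N) (l : List (Letter N)) (v : I →₀ ℂ) :
    component (some h) ((l.map (stepOp s y)).prod (tens none v)) ∈
      Submodule.span ℂ {x | ∃ l' : List (Letter N), (h :: l').Perm l ∧ (l'.map y).prod v = x} := by
  induction l with
  | nil =>
    rw [List.map_nil, List.prod_nil, Op.one_apply, component_tens_of_ne (by simp)]
    exact zero_mem _
  | cons g l ih =>
    have hm : y g (component (some h) ((l.map (stepOp s y)).prod (tens none v))) ∈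
        Submodule.span ℂ
          {x | ∃ l' : List (Letter N), (h :: l').Perm (g :: l) ∧ (l'.map y).prod v = x} := by
      rw [← Op.toEnd_apply]
      refine (Submodule.map_span_le (y g).toEnd _ _).2 ?_ (Submodule.mem_map_of_mem ih)
      rintro _ ⟨l', hl, rfl⟩
      exact Submodule.subset_span ⟨g :: l', (List.Perm.swap g h l').trans (hl.cons g), rfl⟩
    rw [List.map_cons, List.prod_cons, Op.mul_apply]
    by_cases hg : g = h
    · subst hg
      rw [component_some_stepOp_self, component_none_prod]
      exact add_mem (Submodule.subset_span ⟨l, .refl _, rfl⟩) (Submodule.smul_mem _ _ hm)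
    · rw [component_some_stepOp_of_ne hg]
      exact Submodule.smul_mem _ _ hm

theorem component_some_prod_of_notMem {h : Letter N} {l : List (Letter N)} (hl : h ∉ l)
    (v : I →₀ ℂ) : component (some h) ((l.map (stepOp s y)).prod (tens none v)) = 0 := by
  refine (Submodule.mem_bot ℂ).1 (Submodule.span_le.2 ?_ (component_some_prod_mem h l v))
  rintro _ ⟨l', hl', -⟩
  exact absurd (hl'.subset (by simp)) hl

/-- If `h` is even or occurs once, then the ways of creating one of its copies in the first tensor
factor add up without cancellation. -/
theorem component_some_prod_replicate {h : Letter N} {l : List (Letter N)} (hl : h ∉ l) (n : ℕ)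
    (hn : letterParity s h = 0 ∨ n = 0) (v : I →₀ ℂ) :
    component (some h) (((List.replicate (n + 1) h ++ l).map (stepOp s y)).prod (tens none v)) =
      (n + 1 : ℂ) • ((List.replicate n h ++ l).map y).prod v := by
  induction n with
  | zero =>
    rw [List.replicate_one, List.singleton_append, List.map_cons, List.prod_cons, Op.mul_apply,
      component_some_stepOp_self, component_none_prod, component_some_prod_of_notMem hl]
    simp
  | succ n ih =>
    have h0 : letterParity s h = 0 := hn.resolve_right (Nat.succ_ne_zero n)
    rw [List.replicate_succ, List.cons_append, List.map_cons, List.prod_cons, Op.mul_apply,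
      component_some_stepOp_self, component_none_prod, ih (.inl h0), h0, mul_zero, sgn_zero,
      one_smul, map_smul, List.replicate_succ, List.cons_append, List.map_cons, List.prod_cons,
      Op.mul_apply]
    push_cast
    module

end Creation

section LeadingCoefficient

variable {N : ℕ} (s : Fin N → ℤˣ)

/-- The vacuum vector, in which all tensor factors are empty. -/
def vacuum : (d : ℕ) → (Site N d →₀ ℂ)
  | 0 => Finsupp.single () 1
  | d + 1 => (tens none (vacuum d) : Option (Letter N) × Site N d →₀ ℂ)

/-- The basis element in which the letters of `w` occupy the tensor factors, in this order. -/
def stateOf : (w : List (Letter N)) → Site N w.length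
  | [] => ()
  | g :: w => (some g, stateOf w)

/-- The total degree of a word. -/
def wordDeg (w : List (Letter N)) : ℤ := (w.map letterDeg).sum

theorem siteDeg_stateOf (w : List (Letter N)) : siteDeg w.length (stateOf w) = wordDeg w := by
  induction w with
  | nil => rfl
  | cons g w ih =>
    rw [wordDeg, List.map_cons, List.sum_cons, ← wordDeg, ← ih]
    rfl

theorem vacuum_mem (d : ℕ) : (vacuum d : Site N d →₀ ℂ) ∈ degLE (siteDeg d) 0 := by
  induction d with
  | zero => exact single_mem_degLE le_rfl 1
  | succ d ih => exact tens_mem_degLE ih none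

/-- The coefficient of the state `w` in the vector created by the word `l` from the vacuum, in the
tensor power with as many factors as `w` has letters. -/
def leadCoeff (l w : List (Letter N)) : ℂ :=
  (l.map (leadOp s w.length)).prod (vacuum w.length) (stateOf w)

theorem leadCoeff_cons (l w : List (Letter N)) (h : Letter N) :
    leadCoeff s l (h :: w) = component (some h)
      ((l.map (stepOp s (leadOp s w.length))).prod (tens none (vacuum w.length))) (stateOf w) :=
  (component_apply _ _ _).symm

theorem perm_of_leadCoeff_ne_zero {l w : List (Letter N)} (h : leadCoeff s l w ≠ 0) :
    l.Perm w := by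
  induction w generalizing l with
  | nil =>
    cases l with
    | nil => exact .refl _
    | cons g l => exact absurd rfl h
  | cons g w ih =>
    rw [leadCoeff_cons] at h
    by_contra hp
    refine h ?_
    have hm := component_some_prod_mem (s := s) (y := leadOp s w.length) g l (vacuum w.length)
    refine (Submodule.span_le (p := LinearMap.ker
      (Finsupp.lapply (stateOf w) : (Site N w.length →₀ ℂ) →ₗ[ℂ] ℂ))).2 ?_ hm
    rintro _ ⟨l', hl', rfl⟩
    by_contra hne
    exact hp (hl'.symm.trans ((ih hne).cons g))

theorem leadCoeff_replicate_append {h : Letter N} {w : List (Letter N)} (hw : h ∉ w) (n : ℕ)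
    (hn : letterParity s h = 1 → n ≤ 1) (h0 : leadCoeff s w w ≠ 0) :
    leadCoeff s (List.replicate n h ++ w) (List.replicate n h ++ w) ≠ 0 := by
  induction n with
  | zero => exact h0
  | succ n ih =>
    have hz : ∀ z : ZMod 2, z = 0 ∨ z = 1 := by decide
    have hn' : letterParity s h = 0 ∨ n = 0 := by
      rcases hz (letterParity s h) with h | h
      · exact .inl h
      · exact .inr (by have := hn h; omega)
    have e := leadCoeff_cons s (List.replicate (n + 1) h ++ w) (List.replicate n h ++ w) h
    rw [component_some_prod_replicate hw n hn', Finsupp.smul_apply] at e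
    rw [← List.cons_append, ← List.replicate_succ] at e
    rw [e]
    exact smul_ne_zero (by exact_mod_cast Nat.succ_ne_zero n)
      (ih fun h => (Nat.le_succ n).trans (hn h))

/-- The coefficient of the state `w` in the vector created by `w` itself does not vanish, if equal
letters of `w` are adjacent and odd letters occur at most once. -/
theorem leadCoeff_flatMap {K : List (Letter N)} (hK : K.Nodup) (f : Letter N → ℕ)
    (hf : ∀ g ∈ K, letterParity s g = 1 → f g ≤ 1) :
    leadCoeff s (K.flatMap fun g => List.replicate (f g) g)
      (K.flatMap fun g => List.replicate (f g) g) ≠ 0 := by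
  induction K with
  | nil =>
    have e : leadCoeff s [] [] = 1 := Finsupp.single_eq_same
    rw [List.flatMap_nil, e]
    exact one_ne_zero
  | cons g K ih =>
    rw [List.nodup_cons] at hK
    rw [List.flatMap_cons]
    refine leadCoeff_replicate_append s ?_ _ (hf g (by simp))
      (ih hK.2 fun g hg => hf g (by simp [hg]))
    simp only [List.mem_flatMap, List.mem_replicate, not_exists, not_and]
    rintro k hk - rfl
    exact hK.1 hk

end LeadingCoefficient

/-! ### Linear independence of the ordered monomials -/

section Independence

variable {N : ℕ} {s ε : Fin N → ℤˣ}

variable (s) in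
theorem prod_leadOp_mem (d : ℕ) (l : List (Letter N)) :
    (l.map (leadOp s d)).prod ∈ opFilt (siteDeg d) (wordDeg l) := by
  induction l with
  | nil =>
    intro m v hv
    rw [List.map_nil, List.prod_nil, Op.one_apply]
    exact degLE_mono _ (by simp [wordDeg]) hv
  | cons g l ih =>
    rw [List.map_cons, List.prod_cons, wordDeg, List.map_cons, List.sum_cons, ← wordDeg]
    exact (opFilt_isFiltration _).mul_mem (leadOp_mem s d g) ih

/-- The leading part of the action of a word is the product of the creation operators of its
letters, up to a nonzero scalar. -/
theorem rep_phi_word (d : ℕ) (l : List (PBWGen ε)) :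
    ∃ c : ℂ, c ≠ 0 ∧ rep s d (phi s ε (word s ε l)) -
      c • ((l.map PBWGen.letter).map (leadOp s d)).prod ∈
        opFilt (siteDeg d) (wordDeg (l.map PBWGen.letter) - 1) := by
  have hΦ := opFilt_isFiltration (siteDeg (N := N) d)
  induction l with
  | nil => exact ⟨1, one_ne_zero, by simp [word]⟩
  | cons g l ih =>
    obtain ⟨c, hc, h⟩ := ih
    obtain ⟨c', hc', h'⟩ := rep_phi_leading s (ε := ε) d g
    refine ⟨c' * c, mul_ne_zero hc' hc, ?_⟩
    rw [word_cons, map_mul, map_mul, List.map_cons, List.map_cons, List.prod_cons, wordDeg,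
      List.map_cons, List.sum_cons, ← wordDeg]
    have hX := sub_add_cancel (rep s d (phi s ε (bCoeff s ε g.i g.j g.r)))
      (c' • leadOp s d g.letter)
    have hm := add_mem (hΦ.mono (sub_le_self _ zero_le_one) h')
      (Submodule.smul_mem _ c' (leadOp_mem s d g.letter))
    rw [hX] at hm
    have h1 := hΦ.mul_mem hm h
    have h2 := hΦ.mul_mem h' (Submodule.smul_mem _ c (prod_leadOp_mem s d (l.map PBWGen.letter)))
    rw [← add_sub_assoc] at h1
    rw [sub_add_eq_add_sub] at h2
    have h3 := add_mem h1 h2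
    convert h3 using 1
    rw [mul_sub, sub_mul, smul_mul_smul_comm]
    abel

variable (s) in
/-- The coefficient of the state `w` in the image of the vacuum under an element of the super
Yangian. -/
def coeffAt (w : List (Letter N)) : Yangian s →ₗ[ℂ] ℂ where
  toFun x := rep s w.length x (vacuum w.length) (stateOf w)
  map_add' x y := by simp
  map_smul' c x := by simp

/-- Terms of smaller degree do not reach the state `w`. -/
theorem coeffAt_word {w : List (Letter N)} {l : List (PBWGen ε)}
    (h : wordDeg (l.map PBWGen.letter) ≤ wordDeg w) :
    ∃ c : ℂ, c ≠ 0 ∧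
      coeffAt s w (phi s ε (word s ε l)) = c * leadCoeff s (l.map PBWGen.letter) w := by
  obtain ⟨c, hc, hm⟩ := rep_phi_word (s := s) w.length l
  refine ⟨c, hc, ?_⟩
  have h1 := hm 0 _ (vacuum_mem w.length)
  have h2 := (Finsupp.mem_supported' ℂ _).1 h1 (stateOf w) (by
    rw [Set.mem_ofPred_eq, siteDeg_stateOf]
    omega)
  rw [Op.sub_apply, Finsupp.sub_apply, sub_eq_zero, Op.smul_apply, Finsupp.smul_apply] at h2
  exact h2

theorem letter_injective : Function.Injective (PBWGen.letter (ε := ε)) := by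
  intro g h e
  simp only [PBWGen.letter, Prod.mk.injEq] at e
  exact PBWGen.ext e.1 e.2.1 (PNat.natPred_injective e.2.2)

/-- In a linear relation, the functional of an index of maximal degree isolates its coefficient. -/
theorem linearIndependent_of_triangular {ι M : Type*} [AddCommGroup M] [Module ℂ M] (v : ι → M)
    (deg : ι → ℤ) (φ : ι → M →ₗ[ℂ] ℂ) (h1 : ∀ i, φ i (v i) ≠ 0)
    (h2 : ∀ i j, deg j ≤ deg i → j ≠ i → φ i (v j) = 0) : LinearIndependent ℂ v := by
  rw [linearIndependent_iff]
  intro f hf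
  by_contra hne
  obtain ⟨i, hi, hmax⟩ := f.support.exists_max_image deg (Finsupp.support_nonempty_iff.2 hne)
  have h := congrArg (φ i) hf
  rw [Finsupp.linearCombination_apply, Finsupp.sum, map_sum, map_zero, Finset.sum_eq_single i,
    map_smul] at h
  · exact smul_ne_zero (Finsupp.mem_support_iff.1 hi) (h1 i) h
  · intro j hj hji
    rw [map_smul, h2 i j (hmax j hj) hji, smul_zero]
  · exact fun h => absurd hi h

theorem leadCoeff_sortedList [LinearOrder (PBWGen ε)] (f : PBWExponent s ε) :
    leadCoeff s ((sortedList f.1).map PBWGen.letter) ((sortedList f.1).map PBWGen.letter) ≠ 0 := by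
  classical
  let K := (f.1.support.sort (· ≤ ·)).map PBWGen.letter
  let F : Letter N → ℕ := Function.extend PBWGen.letter f.1 0
  have hF : ∀ g : PBWGen ε, F g.letter = f.1 g := fun g => letter_injective.extend_apply _ _ g
  have e : (sortedList f.1).map PBWGen.letter = K.flatMap fun g => List.replicate (F g) g := by
    rw [sortedList, List.map_flatMap, List.flatMap_map]
    simp only [List.map_replicate, hF]
  rw [e]
  refine leadCoeff_flatMap s ((Finset.sort_nodup _ _).map letter_injective) F ?_
  simp only [List.mem_map]
  rintro _ ⟨g, -, rfl⟩ hg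
  rw [hF]
  exact f.2 g hg

theorem linearIndependent_phi_orderedMonomial [LinearOrder (PBWGen ε)] :
    LinearIndependent ℂ fun f : PBWExponent s ε => phi s ε (orderedMonomial s ε f.1) := by
  refine linearIndependent_of_triangular _ (fun f => wordDeg ((sortedList f.1).map PBWGen.letter))
    (fun f => coeffAt s ((sortedList f.1).map PBWGen.letter)) (fun f => ?_) fun f f' hd hne => ?_
  · obtain ⟨c, hc, h⟩ := coeffAt_word (s := s) (l := sortedList f.1) le_rfl
    rw [← word_sortedList, h]
    exact mul_ne_zero hc (leadCoeff_sortedList f)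
  · obtain ⟨c, hc, h⟩ := coeffAt_word (s := s) (l := sortedList f'.1) hd
    rw [← word_sortedList, h]
    by_contra hz
    have hp := perm_of_leadCoeff_ne_zero s (right_ne_zero_of_mul hz)
    rw [← Multiset.coe_eq_coe, ← Multiset.map_coe, ← Multiset.map_coe] at hp
    have := Multiset.map_injective letter_injective hp
    rw [coe_sortedList, coe_sortedList] at this
    exact hne (Subtype.ext ((AddEquiv.injective Multiset.toFinsupp.symm) this))

/-- The ordered monomials form a basis of the twisted super Yangian. -/
def pbwBasis (s ε : Fin N → ℤˣ) [LinearOrder (PBWGen ε)] :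
    Module.Basis (PBWExponent s ε) ℂ (TwistedYangian s ε) :=
  Module.Basis.mk (v := fun f : PBWExponent s ε => orderedMonomial s ε f.1)
    (linearIndependent_phi_orderedMonomial.of_comp (phi s ε).toLinearMap)
    span_orderedMonomial.ge

theorem pbwBasis_apply [LinearOrder (PBWGen ε)] (f : PBWExponent s ε) :
    pbwBasis s ε f = orderedMonomial s ε f.1 :=
  Module.Basis.mk_apply _ _ f

theorem phi_injective : Function.Injective (phi s ε) := by
  -- any ordering of the generators gives a basis with linearly independent image
  let _ : LinearOrder (PBWGen ε) := IsWellOrder.linearOrder WellOrderingRel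
  have h : (Finsupp.linearCombination ℂ fun f : PBWExponent s ε =>
      phi s ε (orderedMonomial s ε f.1)) = (phi s ε).toLinearMap ∘ₗ (pbwBasis s ε).repr.symm := by
    refine Finsupp.lhom_ext' fun f => LinearMap.ext_ring ?_
    simp [pbwBasis_apply]
  have h' := linearIndependent_phi_orderedMonomial (s := s) (ε := ε)
  rw [LinearIndependent, h] at h'
  intro x y hxy
  obtain ⟨x, rfl⟩ := (pbwBasis s ε).repr.symm.surjective x
  obtain ⟨y, rfl⟩ := (pbwBasis s ε).repr.symm.surjective y
  rw [h' hxy]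

end Independence

end SuperYangian

end

theorem mainTheorem4 (m n : ℕ) (s : Fin (m + n) → ℤˣ)
    (hs : (Finset.univ.filter fun i => s i = 1).card = m) (ε : Fin (m + n) → ℤˣ) :
    (∃ φ : SuperYangian.twistedParity s ε →ₐᵍ[ℂ] SuperYangian.yangianParity s,
      SuperYangian.mapSeries (φ : SuperYangian.TwistedYangian s ε →ₐ[ℂ] SuperYangian.Yangian s)
          (SuperYangian.B s ε) =
        SuperYangian.T s * SuperYangian.G s ε * SuperYangian.negArg (SuperYangian.TInv s) ∧
      Function.Injective φ) ∧
    ∀ _ : LinearOrder (SuperYangian.PBWGen ε),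
      ∃ basis : Module.Basis (SuperYangian.PBWExponent s ε) ℂ (SuperYangian.TwistedYangian s ε),
        ∀ f, basis f = SuperYangian.orderedMonomial s ε f.1 :=
  ⟨⟨SuperYangian.gradedPhi s ε, SuperYangian.mapSeries_phi s ε, SuperYangian.phi_injective⟩,
    fun _ => ⟨SuperYangian.pbwBasis s ε, SuperYangian.pbwBasis_apply⟩⟩
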